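/- Let $\zeta$ be the Riemann zeta-function. For an integer $k\ge 3$ let $d_k(n)$ denote the number of ways to write $n$ as an ordered product $n_1n_2\cdots n_k$ of positive integers, and for real $x>0$ let $$\Delta_k(x)=\sum_{n\le x}d_k(n)-\operatorname*{Res}_{s=1}\left(\frac{\zeta(s)^k x^s}{s}\right).$$ Assume the Lindelöf hypothesis, that is, for every $\eta>0$ one has $\zeta(\tfrac12+it)=O_\eta(t^{\eta})$ as $t\to\infty$. Then for every integer $k\ge 3$ and every $\varepsilon>0$ there is a constant $C>0$, depending only on $k$ and $\varepsilon$, such that for all real numbers $X$ and $h$ with $1\le h\le X/8$ the function $x\mapsto(\Delta_k(x+h)-\Delta_k(x))^2$ is integrable on $[X,2X]$ and $$\frac1X\int_X^{2X}\bigl(\Delta_k(x+h)-\Delta_k(x)\bigr)^2\,dx\le C\,h\,X^{\varepsilon}.$$ -/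

import Mathlib

noncomputable section

namespace PiltzDivisor

open Filter Topology

/-- The `k`-fold divisor function `d_k(n)`: the number of ordered `k`-tuples of positive integers
whose product is `n` (for `n ≥ 1`). -/
def divisorFunction (k n : ℕ) : ℕ :=
  (Nat.finMulAntidiag k n).card

/-- The residue of `f` at an isolated singularity `c`: the value of
`(2πi)⁻¹ ∮_{|z - c| = r} f(z) dz` for all sufficiently small `r > 0`, expressed as the limit
when `r → 0⁺`. -/
def residue (f : ℂ → ℂ) (c : ℂ) : ℂ :=
  limUnder (𝓝[>] (0 : ℝ)) fun r : ℝ =>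
    (2 * (Real.pi : ℂ) * Complex.I)⁻¹ * ∮ z in C(c, r), f z

/-- The error term `Δ_k(x) = ∑_{n ≤ x} d_k(n) - Res_{s = 1} (ζ(s)^k x^s / s)`, for `x > 0`.
The residue is a real number, so taking its real part only changes its type. -/
def Delta (k : ℕ) (x : ℝ) : ℝ :=
  (∑ n ∈ Finset.Icc 1 ⌊x⌋₊, (divisorFunction k n : ℝ)) -
    (residue (fun s : ℂ => riemannZeta s ^ k * (x : ℂ) ^ s / s) 1).re

/-- The Lindelöf hypothesis: for every `ε > 0`, `ζ(1/2 + it) = O(t^ε)` as `t → ∞`. -/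
def LindelofHypothesis : Prop :=
  ∀ ε : ℝ, 0 < ε →
    (fun t : ℝ => riemannZeta (1 / 2 + (t : ℂ) * Complex.I)) =O[atTop] fun t : ℝ => t ^ ε

end PiltzDivisor

end

/-! ### Plancherel, Gaussian-regularised Fourier inversion and contour shifting. -/

noncomputable section

namespace PiltzDivisor

open Filter Topology MeasureTheory Complex FourierTransform

/-! In the variable `x = e^v`, cut off to `v > 0`, the error term `Δ_k` has Laplace transform
`R(s)`, which is `ζ(s)^k / s` minus its principal part at `s = 1`. Subtracting the residue from the
divisor sum is exactly what removes the pole, so `R` is holomorphic in `Re s > 0`, although the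
Laplace integral itself is only computed for `Re s > 3/2`. Replacing `v` by `v + δ` multiplies the
transform by `e^{δs}`, so the difference `Δ_k(e^{v+δ}) - Δ_k(e^v)` has transform `R(s)(e^{δs} - 1)`.

A Mellin–Plancherel inequality (`lintegral_sq_le_of_laplace`) bounds the mean square of this
difference, with weight `e^{-v}`, by the integral of `|R(s)(e^{δs} - 1)|²` over `Re s = 1/2`. The
Lindelöf hypothesis gives `R(1/2 + it) ≪ (1 + |t|)^{η-1}`, and `|e^{δs} - 1| ≪ (δ|s|)^{(1-ε)/2}`, so
the integral converges and is `≪ δ^{1-ε}` (`exists_lintegral_logError_sub_le`). With `1 + θ = e^δ`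
this says that `∫_1^∞ (Δ_k(x + θx) - Δ_k(x))² x^{-2} dx ≪ θ^{1-ε}`.

This controls increments of length proportional to `x`. The Saffari–Vaughan argument passes to a
fixed length `h`: the increment over `h` is a difference of two increments of lengths `v` and `v -
h`, averaged over `v` of order `h`. The substitution `v = θx` and Fubini then reduce to `θ` of order
`h/X`, giving about `X² (h/X)^{1-ε} ≤ h X^{1+ε}` for the integral over `[X, 2X]`. -/

/-- **Plancherel's identity** for integrable square-integrable functions on the line. -/
theorem lintegral_enorm_fourier_sq {W : ℝ → ℂ} (h1 : Integrable W) (h2 : MemLp W 2) :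
    ∫⁻ u, ‖𝓕 W u‖ₑ ^ 2 = ∫⁻ t, ‖W t‖ₑ ^ 2 := by
  have hcont : Continuous (𝓕 W) := VectorFourier.fourierIntegral_continuous
    Real.continuous_fourierChar continuous_inner h1
  have key : (𝓕 (h2.toLp W) : Lp ℂ 2 (volume : Measure ℝ)) =ᵐ[volume] 𝓕 W := by
    -- The abstract `L²` transform and the Fourier integral are identified by testing against smooth
    -- compactly supported `g`: in both cases the transform can be moved onto `g`.
    refine ae_eq_of_integral_contDiff_smul_eq
      ((Lp.memLp _).locallyIntegrable (by norm_num)) hcont.locallyIntegrable ?_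
    intro g hg hgc
    let φ : SchwartzMap ℝ ℂ :=
      HasCompactSupport.toSchwartzMap (f := fun x => (g x : ℂ))
        (hgc.comp_left (g := fun x : ℝ => (x : ℂ)) (by simp)) (by
          exact Complex.ofRealCLM.contDiff.comp hg)
    have e1 := congrArg (fun T => T φ) (Lp.fourier_toTemperedDistribution_eq (h2.toLp W))
    simp only [TemperedDistribution.fourier_apply, Lp.toTemperedDistribution_apply] at e1
    have e2 : ∫ x, (𝓕 φ) x • (h2.toLp W) x = ∫ x, (𝓕 φ) x • W x := by
      refine integral_congr_ae ?_
      filter_upwards [h2.coeFn_toLp] with x hx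
      rw [hx]
    have e3 : ∫ x, (𝓕 (φ : ℝ → ℂ)) x • W x = ∫ x, φ x • 𝓕 W x := by
      simpa using! (VectorFourier.integral_fourierIntegral_smul_eq_flip (L := innerₗ ℝ)
        Real.continuous_fourierChar continuous_inner φ.integrable h1)
    have e4 : ∀ x, φ x = (g x : ℂ) := fun x => rfl
    have e5 : ∫ x, (𝓕 φ) x • W x = ∫ x, (𝓕 (φ : ℝ → ℂ)) x • W x := rfl
    rw [e2, e5, e3] at e1
    simpa [e4] using e1.symm
  have hn := Lp.norm_fourier_eq (h2.toLp W)
  rw [Lp.norm_def, Lp.norm_def, ENNReal.toReal_eq_toReal_iff' (Lp.eLpNorm_ne_top _)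
    (Lp.eLpNorm_ne_top _), eLpNorm_congr_ae key, eLpNorm_congr_ae h2.coeFn_toLp] at hn
  have h3 := congrArg (fun x => x ^ (2 : ℝ)) hn
  have h4 : ∀ a : ENNReal, (a ^ (2⁻¹ : ℝ)) ^ 2 = a := fun a => by
    rw [← ENNReal.rpow_natCast, ← ENNReal.rpow_mul]; norm_num
  simpa [eLpNorm_eq_lintegral_rpow_enorm_toReal, h4] using h3

/-- Gaussian regularisation of Fourier inversion at a point of continuity. -/
theorem tendsto_gaussian_fourier {F : ℝ → ℂ} (hF : Integrable F) {u : ℝ}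
    (hu : ContinuousAt F u) :
    Tendsto (fun c : ℝ => ∫ w : ℝ, cexp (-c⁻¹ * w ^ 2 + 2 * Real.pi * I * (u * w)) * 𝓕 F w)
      atTop (𝓝 (F u)) := by
  have hsq : ∀ w : ℝ, ((‖w‖ : ℝ) : ℂ) ^ 2 = (w : ℂ) ^ 2 := fun w => by
    rw [← ofReal_pow, ← ofReal_pow]; simp
  refine (Real.tendsto_integral_gaussian_smul' hF hu).congr' ?_
  filter_upwards [Ioi_mem_atTop 0] with c (hc : 0 < c)
  have J : Integrable (fun w : ℝ ↦ cexp (- c⁻¹ * ‖w‖ ^ 2 + 2 * Real.pi * I * inner ℝ u w)) :=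
    GaussianFourier.integrable_cexp_neg_mul_sq_norm_add (by simpa) _ _
  -- Self-adjointness moves the transform from the Gaussian onto `F`; the transformed Gaussian is an
  -- approximate identity at `u`.
  have h := (VectorFourier.integral_fourierIntegral_smul_eq_flip (L := innerₗ ℝ)
      Real.continuous_fourierChar continuous_inner J hF)
  have h' : ∫ w : ℝ, 𝓕 (fun w : ℝ ↦ cexp (- c⁻¹ * ‖w‖ ^ 2 + 2 * Real.pi * I * inner ℝ u w)) w • F w
      = ∫ w : ℝ, cexp (-c⁻¹ * w ^ 2 + 2 * Real.pi * I * (u * w)) * 𝓕 F w := by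
    refine h.trans (integral_congr_ae (.of_forall fun w => ?_))
    have hin : ((inner ℝ u w : ℝ) : ℂ) = u * w := by simp [mul_comm]
    simp only [hsq, hin]
    rw [flip_innerₗ]
    rfl
  rw [← h']
  congr with w
  rw [fourier_gaussian_innerProductSpace' (by simpa)]
  simp only [hsq, div_eq_mul_inv, ofReal_inv, inv_inv, smul_eq_mul]
  congr 3
  ring

/-- Shifting the line of integration across a vertical strip. -/
theorem integral_vertical_eq {H : ℂ → ℂ} {a b : ℝ} (hab : a ≤ b) {B : ℝ → ℝ}
    (hd : DifferentiableOn ℂ H {s | s.re ∈ Set.Icc a b})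
    (hB : Integrable B) (hB0 : Tendsto B (cocompact ℝ) (𝓝 0))
    (hbound : ∀ σ ∈ Set.Icc a b, ∀ t : ℝ, ‖H (σ + t * I)‖ ≤ B t) :
    ∫ t : ℝ, H (a + t * I) = ∫ t : ℝ, H (b + t * I) := by
  have hint : ∀ σ ∈ Set.Icc a b, Integrable fun t : ℝ => H (σ + t * I) := by
    intro σ hσ
    refine hB.mono' ?_ (.of_forall (hbound σ hσ))
    refine Continuous.aestronglyMeasurable ?_
    exact hd.continuousOn.comp_continuous (by fun_prop) (by simpa using hσ)
  have hlim : ∀ σ ∈ Set.Icc a b, Tendsto (fun T : ℝ => ∫ t in (-T)..T, H (σ + t * I)) atTop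
      (𝓝 (∫ t : ℝ, H (σ + t * I))) := fun σ hσ =>
    intervalIntegral_tendsto_integral (hint σ hσ) tendsto_neg_atTop_atBot tendsto_id
  have hhor : ∀ g : ℝ → ℝ, Tendsto g atTop (cocompact ℝ) →
      Tendsto (fun T : ℝ => ∫ x in a..b, H (x + (g T : ℝ) * I)) atTop (𝓝 0) := by
    intro g hg
    have h1 : Tendsto (fun T => B (g T) * |b - a|) atTop (𝓝 0) := by
      simpa using (hB0.comp hg).mul_const |b - a|
    refine squeeze_zero_norm (fun T => ?_) h1
    refine intervalIntegral.norm_integral_le_of_norm_le_const fun x hx => ?_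
    rw [Set.uIoc_of_le hab] at hx
    exact hbound x ⟨hx.1.le, hx.2⟩ _
  -- Cauchy's theorem on the rectangle of height `2T`; the horizontal sides vanish as `T → ∞`
  -- because `B` tends to zero.
  have hrect : ∀ T : ℝ, (∫ x in a..b, H (x + ((-T : ℝ) : ℂ) * I)) - (∫ x in a..b, H (x + (T : ℝ) * I))
      + I • (∫ t in (-T)..T, H (b + t * I)) - I • (∫ t in (-T)..T, H (a + t * I)) = 0 := by
    intro T
    have := Complex.integral_boundary_rect_eq_zero_of_differentiableOn H (a + (-T : ℝ) * I)
      (b + T * I) (hd.mono ?_)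
    · simpa using this
    · intro s hs
      rw [mem_reProdIm] at hs
      simpa [Set.uIcc_of_le hab] using hs.1
  have hL := (((hhor (fun T => -T) ?_).sub (hhor (fun T => T) ?_)).add
    ((hlim b ⟨hab, le_rfl⟩).const_smul I)).sub ((hlim a ⟨le_rfl, hab⟩).const_smul I)
  · simp only [hrect] at hL
    have h0 := tendsto_nhds_unique hL tendsto_const_nhds
    have h1 : I * (∫ t : ℝ, H (b + t * I)) - I * (∫ t : ℝ, H (a + t * I)) = 0 := by
      simpa using h0
    rw [← mul_sub, mul_eq_zero, sub_eq_zero] at h1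
    exact (h1.resolve_left I_ne_zero).symm
  · rw [cocompact_eq_atBot_atTop]
    exact tendsto_neg_atTop_atBot.mono_right le_sup_left
  · rw [cocompact_eq_atBot_atTop]
    exact tendsto_id.mono_right le_sup_right

end PiltzDivisor

end

/-! ### The Mellin–Plancherel inequality. -/

noncomputable section

namespace PiltzDivisor

open Filter Topology MeasureTheory Complex FourierTransform

theorem exists_one_add_abs_pow_mul_exp_le (k : ℕ) {b : ℝ} (hb : 0 < b) :
    ∃ K : ℝ, 0 ≤ K ∧ ∀ t : ℝ, (1 + |t|) ^ k * Real.exp (-b * t ^ 2) ≤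
      K * Real.exp (-(b / 2) * t ^ 2) := by
  refine ⟨k.factorial * Real.exp (1 + 1 / (2 * b)), by positivity, fun t => ?_⟩
  have h1 : (1 + |t|) ^ k ≤ k.factorial * Real.exp (1 + |t|) := by
    have := Real.pow_div_factorial_le_exp (1 + |t|) (by positivity) k
    rwa [div_le_iff₀ (by positivity), mul_comm] at this
  have h2 : |t| ≤ b / 2 * t ^ 2 + 1 / (2 * b) := by
    rw [← sq_abs t]
    have : b / 2 * |t| ^ 2 + 1 / (2 * b) - |t| = (b * |t| - 1) ^ 2 / (2 * b) := by
      field_simp; ring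
    have : 0 ≤ (b * |t| - 1) ^ 2 / (2 * b) := by positivity
    linarith
  calc (1 + |t|) ^ k * Real.exp (-b * t ^ 2)
      ≤ k.factorial * Real.exp (1 + |t|) * Real.exp (-b * t ^ 2) := by gcongr
    _ = k.factorial * Real.exp (1 + |t| + -b * t ^ 2) := by rw [mul_assoc, ← Real.exp_add]
    _ ≤ k.factorial * Real.exp (1 + 1 / (2 * b) + -(b / 2) * t ^ 2) := by
        gcongr ?_ * Real.exp ?_
        linarith
    _ = _ := by rw [Real.exp_add]; ring

theorem tendsto_exp_neg_mul_sq_cocompact {b : ℝ} (hb : 0 < b) :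
    Tendsto (fun t : ℝ => Real.exp (-b * t ^ 2)) (cocompact ℝ) (𝓝 0) := by
  simpa using tendsto_rpow_abs_mul_exp_neg_mul_sq_cocompact hb 0

/-- The Mellin–Plancherel inequality on the line `Re s = 1/2` for a function whose Laplace
transform is known on the line `Re s = 2` and continues holomorphically, with at most polynomial
growth, to the strip between these lines. -/
theorem lintegral_sq_le_of_laplace {f : ℝ → ℂ} {H : ℂ → ℂ} {C : ℝ} {k : ℕ} (hC : 0 ≤ C)
    (hf : Integrable fun v : ℝ => f v * cexp (-2 * v))
    (hcont : ∀ᵐ u, ContinuousAt f u)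
    (hH : DifferentiableOn ℂ H {s | 0 < s.re})
    (hb : ∀ σ ∈ Set.Icc (1 / 2 : ℝ) 2, ∀ t : ℝ, ‖H (σ + t * I)‖ ≤ C * (1 + |t|) ^ k)
    (hlap : ∀ t : ℝ, ∫ v : ℝ, f v * cexp (-(2 + t * I) * v) = H (2 + t * I)) :
    ∫⁻ u : ℝ, ‖f u * cexp (-(1 / 2) * u)‖ₑ ^ 2 ≤
      ∫⁻ w : ℝ, ‖H (1 / 2 + (2 * Real.pi * w : ℝ) * I)‖ₑ ^ 2 := by
  -- Chosen so that on `Re s = 2`, with `s - 2 = 2πiw`, the damping `e^{b_n (s-2)²}` is the Gaussian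
  -- `e^{-w²/(n+1)}` of the regularised inversion.
  set b : ℕ → ℝ := fun n => (4 * Real.pi ^ 2 * (n + 1))⁻¹ with hbdef
  have hbpos : ∀ n, 0 < b n := fun n => by positivity
  set W : ℕ → ℝ → ℂ := fun n w =>
    cexp (b n * (-3 / 2 + (2 * Real.pi * w : ℝ) * I) ^ 2) * H (1 / 2 + (2 * Real.pi * w : ℝ) * I)
    with hW
  set G : ℕ → ℝ → ℂ → ℂ := fun n u s => cexp (b n * (s - 2) ^ 2 + u * (s - 1 / 2)) * H s with hG
  have hGd : ∀ n u, DifferentiableOn ℂ (G n u) {s | 0 < s.re} := fun n u =>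
    DifferentiableOn.mul (by fun_prop) hH
  have hsub : {s : ℂ | s.re ∈ Set.Icc (1 / 2 : ℝ) 2} ⊆ {s | 0 < s.re} := fun s hs =>
    lt_of_lt_of_le (by norm_num) hs.1
  have hGb : ∀ n u, ∃ K : ℝ, 0 ≤ K ∧ ∀ σ ∈ Set.Icc (1 / 2 : ℝ) 2, ∀ t : ℝ,
      ‖G n u (σ + t * I)‖ ≤ K * Real.exp (-(b n / 2) * t ^ 2) := by
    intro n u
    obtain ⟨K, hK0, hK⟩ := exists_one_add_abs_pow_mul_exp_le k (hbpos n)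
    refine ⟨Real.exp (b n * (9 / 4) + |u| * (3 / 2)) * C * K, by positivity, fun σ hσ t => ?_⟩
    simp only [hG]
    rw [norm_mul, norm_exp]
    have e : (b n * ((σ : ℂ) + t * I - 2) ^ 2 + u * (σ + t * I - 1 / 2)).re
        = b n * ((σ - 2) ^ 2 - t ^ 2) + u * (σ - 1 / 2) := by
      simp [pow_two]
    rw [e]
    have h1 : b n * ((σ - 2) ^ 2 - t ^ 2) + u * (σ - 1 / 2) ≤
        (b n * (9 / 4) + |u| * (3 / 2)) + -b n * t ^ 2 := by
      have h2 : (σ - 2) ^ 2 ≤ 9 / 4 := by nlinarith [hσ.1, hσ.2]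
      have h3 : u * (σ - 1 / 2) ≤ |u| * (3 / 2) := by
        have := le_abs_self u
        have h4 : 0 ≤ σ - 1 / 2 := by linarith [hσ.1]
        calc u * (σ - 1 / 2) ≤ |u| * (σ - 1 / 2) := by gcongr
          _ ≤ _ := by gcongr; linarith [hσ.2]
      have := mul_le_mul_of_nonneg_left h2 (hbpos n).le
      linarith
    calc _ ≤ Real.exp ((b n * (9 / 4) + |u| * (3 / 2)) + -b n * t ^ 2) * (C * (1 + |t|) ^ k) := by
          gcongr
          exact hb σ hσ t
      _ = Real.exp (b n * (9 / 4) + |u| * (3 / 2)) * C *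
          ((1 + |t|) ^ k * Real.exp (-b n * t ^ 2)) := by rw [Real.exp_add]; ring
      _ ≤ _ := by
          rw [mul_assoc _ K]
          exact mul_le_mul_of_nonneg_left (hK t) (by positivity)
  have hWG : ∀ n w, W n w = G n 0 ((1 / 2 : ℝ) + (2 * Real.pi * w : ℝ) * I) := by
    intro n w
    simp only [hW, hG]
    push_cast
    congr 2
    ring
  have hWc : ∀ n, Continuous (W n) := by
    intro n
    simp_rw [funext (hWG n)]
    refine (hGd n 0).continuousOn.comp_continuous (by fun_prop) fun w => ?_
    simp
  have hWi : ∀ n, Integrable (W n) ∧ MemLp (W n) 2 := by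
    intro n
    obtain ⟨K, hK0, hK⟩ := hGb n 0
    have hp : 0 < b n / 2 * (2 * Real.pi) ^ 2 := by have := hbpos n; positivity
    have hle : ∀ w, ‖W n w‖ ≤ K * Real.exp (-(b n / 2 * (2 * Real.pi) ^ 2) * w ^ 2) := by
      intro w
      rw [hWG]
      refine (hK _ (by norm_num) _).trans (le_of_eq ?_)
      congr 2
      ring
    have hi : Integrable (W n) :=
      ((integrable_exp_neg_mul_sq hp).const_mul K).mono' (hWc n).aestronglyMeasurable
        (.of_forall hle)
    refine ⟨hi, (memLp_two_iff_integrable_sq_norm hi.1).2 ?_⟩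
    refine (hi.norm.const_mul K).mono' ((hWc n).norm.pow 2).aestronglyMeasurable
      (.of_forall fun w => ?_)
    have : ‖W n w‖ ≤ K := (hle w).trans (mul_le_of_le_one_right hK0 (by
      rw [Real.exp_le_one_iff]
      have := mul_nonneg hp.le (sq_nonneg w)
      linarith))
    rw [Real.norm_of_nonneg (by positivity), pow_two]
    gcongr
  -- On `Re s = 1/2` the exponent has real part `b_n (9/4 - t²) ≤ 9 b_n / 4`; squaring doubles it.
  have hWle : ∀ n, ∫⁻ w, ‖W n w‖ₑ ^ 2 ≤ ENNReal.ofReal (Real.exp (b n * (9 / 2))) *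
      ∫⁻ w : ℝ, ‖H (1 / 2 + (2 * Real.pi * w : ℝ) * I)‖ₑ ^ 2 := by
    intro n
    rw [← lintegral_const_mul' _ _ ENNReal.ofReal_ne_top]
    refine lintegral_mono fun w => ?_
    simp only [hW, enorm_mul, mul_pow]
    gcongr
    rw [← ofReal_norm, norm_exp, ← ENNReal.ofReal_pow (by positivity), ← Real.exp_nat_mul]
    refine ENNReal.ofReal_le_ofReal (Real.exp_le_exp.2 ?_)
    have e : (b n * (-3 / 2 + ((2 * Real.pi * w : ℝ) : ℂ) * I) ^ 2).re
        = b n * (9 / 4 - (2 * Real.pi * w) ^ 2) := by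
      rw [pow_two, re_ofReal_mul, mul_re]
      simp
      left
      ring
    rw [e]
    have := mul_nonneg (hbpos n).le (sq_nonneg (2 * Real.pi * w))
    push_cast
    linarith
  have hF : ∀ w : ℝ, 𝓕 (fun v : ℝ => f v * cexp (-2 * v)) w = H (2 + (2 * Real.pi * w : ℝ) * I) := by
    intro w
    rw [Real.fourier_real_eq_integral_exp_smul, ← hlap]
    congr with v
    rw [smul_eq_mul, mul_left_comm, ← Complex.exp_add]
    congr 2
    push_cast
    ring
  -- Shifting to `Re s = 2` turns `𝓕 (W n) (-u)` into the regularised inversion of `f(v) e^{-2v}` at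
  -- `u`, times `e^{3u/2}`.
  have hlim : ∀ u, ContinuousAt f u →
      Tendsto (fun n => 𝓕 (W n) (-u)) atTop (𝓝 (f u * cexp (-(1 / 2) * u))) := by
    intro u hu
    have hcF : ContinuousAt (fun v : ℝ => f v * cexp (-2 * v)) u := hu.mul (by fun_prop)
    have h1 := ((tendsto_gaussian_fourier hf hcF).comp
      (tendsto_atTop_add_const_right atTop (1 : ℝ) tendsto_natCast_atTop_atTop)).mul_const
      (cexp (3 / 2 * u))
    have h2 : f u * cexp (-2 * u) * cexp (3 / 2 * u) = f u * cexp (-(1 / 2) * u) := by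
      rw [mul_assoc, ← Complex.exp_add]
      congr 2
      ring
    rw [h2] at h1
    refine h1.congr fun n => ?_
    have hline : ∀ g : ℝ → ℂ, ∫ w : ℝ, g (2 * Real.pi * w) = (2 * Real.pi : ℝ)⁻¹ • ∫ t, g t := by
      intro g
      rw [Measure.integral_comp_mul_left, abs_of_pos (by positivity)]
    obtain ⟨K, hK0, hK⟩ := hGb n u
    have hshift := integral_vertical_eq (H := G n u) (a := 1 / 2) (b := 2) (by norm_num)
      (B := fun t => K * Real.exp (-(b n / 2) * t ^ 2)) ((hGd n u).mono hsub)
      ((integrable_exp_neg_mul_sq (half_pos (hbpos n))).const_mul K)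
      (by simpa using (tendsto_exp_neg_mul_sq_cocompact (half_pos (hbpos n))).const_mul K) hK
    have e1 := hline fun t => G n u ((1 / 2 : ℝ) + t * I)
    have e2 := hline fun t => G n u ((2 : ℝ) + t * I)
    rw [hshift, ← e2] at e1
    simp only [Function.comp_apply]
    rw [← integral_mul_const, Real.fourier_real_eq_integral_exp_smul]
    trans ∫ w : ℝ, G n u ((2 : ℝ) + (2 * Real.pi * w : ℝ) * I)
    · congr with w
      rw [hF]
      simp only [hG]
      rw [mul_right_comm, ← Complex.exp_add]
      push_cast
      congr 2
      have : (b n : ℂ) = (4 * (Real.pi : ℂ) ^ 2 * ((n : ℂ) + 1))⁻¹ := by simp [hbdef]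
      rw [this]
      have hn : (n + 1 : ℂ) ≠ 0 := by exact_mod_cast n.succ_ne_zero
      have hpi : (Real.pi : ℂ) ≠ 0 := by exact_mod_cast Real.pi_ne_zero
      field_simp
      ring_nf
      rw [I_sq]
      ring
    · rw [← e1]
      congr with w
      simp only [hG, hW, smul_eq_mul]
      rw [← mul_assoc, ← Complex.exp_add]
      push_cast
      congr 2
      ring
  -- Fatou's lemma needs only the pointwise limit almost everywhere, so an inequality is obtained
  -- without first knowing that the left side is finite.
  calc ∫⁻ u : ℝ, ‖f u * cexp (-(1 / 2) * u)‖ₑ ^ 2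
      = ∫⁻ u : ℝ, liminf (fun n => ‖𝓕 (W n) (-u)‖ₑ ^ 2) atTop := by
        refine lintegral_congr_ae ?_
        filter_upwards [hcont] with u hu
        exact (((ENNReal.continuous_pow 2).tendsto _).comp (hlim u hu).enorm).liminf_eq.symm
    _ ≤ liminf (fun n => ∫⁻ u : ℝ, ‖𝓕 (W n) (-u)‖ₑ ^ 2) atTop := by
        refine lintegral_liminf_le fun n => ?_
        have : Continuous (𝓕 (W n)) := VectorFourier.fourierIntegral_continuous
          Real.continuous_fourierChar continuous_inner (hWi n).1
        exact (this.comp continuous_neg).measurable.enorm.pow_const 2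
    _ ≤ liminf (fun n => ENNReal.ofReal (Real.exp (b n * (9 / 2))) *
          ∫⁻ w : ℝ, ‖H (1 / 2 + (2 * Real.pi * w : ℝ) * I)‖ₑ ^ 2) atTop := by
        refine liminf_le_liminf (.of_forall fun n => ?_)
        rw [lintegral_neg_eq_self (fun u => ‖𝓕 (W n) u‖ₑ ^ 2),
          lintegral_enorm_fourier_sq (hWi n).1 (hWi n).2]
        exact hWle n
    _ = _ := by
        have hb0 : Tendsto b atTop (𝓝 0) := by
          have := (tendsto_one_div_add_atTop_nhds_zero_nat (𝕜 := ℝ)).const_mul (4 * Real.pi ^ 2)⁻¹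
          simpa [hbdef, mul_comm] using this
        have h1 : Tendsto (fun n => ENNReal.ofReal (Real.exp (b n * (9 / 2)))) atTop (𝓝 1) := by
          have : Tendsto (fun n => Real.exp (b n * (9 / 2))) atTop (𝓝 (Real.exp (0 * (9 / 2)))) :=
            (Real.continuous_exp.tendsto _).comp (hb0.mul_const _)
          simpa using ENNReal.tendsto_ofReal this
        have h2 := ENNReal.Tendsto.mul_const (b := ∫⁻ w : ℝ, ‖H (1 / 2 + (2 * Real.pi * w : ℝ) * I)‖ₑ ^ 2)
          h1 (Or.inl one_ne_zero)
        rw [one_mul] at h2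
        exact h2.liminf_eq

end PiltzDivisor

end

/-! ### Continuation and growth of zeta; Dirichlet series of the divisor function. -/

noncomputable section

namespace PiltzDivisor

open Filter Topology MeasureTheory Complex Set

/-- The sawtooth function `t - ⌊t⌋` on `(1, ∞)`, extended by zero. -/
def sawtooth : ℝ → ℂ := indicator (Ioi 1) fun t => ((t - ⌊t⌋₊ : ℝ) : ℂ)

theorem norm_sawtooth_le (t : ℝ) : ‖sawtooth t‖ ≤ 1 := by
  unfold sawtooth
  by_cases ht : t ∈ Ioi (1 : ℝ)
  · rw [indicator_of_mem ht, norm_real, Real.norm_eq_abs, abs_le]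
    have h0 : (0 : ℝ) ≤ t := by linarith [mem_Ioi.1 ht]
    constructor <;> linarith [Nat.floor_le h0, Nat.lt_floor_add_one t]
  · simp [indicator_of_notMem ht]

theorem measurable_sawtooth : Measurable sawtooth := by
  refine Measurable.indicator ?_ measurableSet_Ioi
  refine Complex.measurable_ofReal.comp (measurable_id.sub ?_)
  exact (measurable_from_top (f := fun n : ℕ => (n : ℝ))).comp Nat.measurable_floor

theorem mellin_sawtooth_eq (s : ℂ) :
    mellin sawtooth (-s) = ∫ t in Ioi (1 : ℝ), (t : ℂ) ^ (-s - 1) * ((t - ⌊t⌋₊ : ℝ) : ℂ) := by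
  rw [mellin, ← integral_indicator measurableSet_Ioi, ← integral_indicator measurableSet_Ioi]
  congr with t
  by_cases ht : t ∈ Ioi (1 : ℝ)
  · rw [indicator_of_mem ht, indicator_of_mem (show t ∈ Ioi (0 : ℝ) from one_pos.trans (mem_Ioi.1 ht)),
      sawtooth, indicator_of_mem ht, smul_eq_mul]
  · rw [indicator_of_notMem ht]
    unfold sawtooth
    by_cases h0 : t ∈ Ioi (0 : ℝ)
    · rw [indicator_of_mem h0, indicator_of_notMem ht, smul_zero]
    · rw [indicator_of_notMem h0]

theorem norm_mellin_sawtooth_le {s : ℂ} (hs : 0 < s.re) :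
    ‖mellin sawtooth (-s)‖ ≤ 1 / s.re := by
  rw [mellin_sawtooth_eq]
  have hi : ∫ t in Ioi (1 : ℝ), t ^ (-s.re - 1) = 1 / s.re := by
    rw [integral_Ioi_rpow_of_lt (by linarith) one_pos]
    rw [Real.one_rpow, show -s.re - 1 + 1 = -s.re by ring, neg_div_neg_eq]
  rw [← hi]
  refine norm_integral_le_of_norm_le (integrableOn_Ioi_rpow_of_lt (by linarith) one_pos) ?_
  refine (ae_restrict_mem measurableSet_Ioi).mono fun t ht => ?_
  have h0 : (0 : ℝ) < t := by linarith [mem_Ioi.1 ht]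
  rw [norm_mul, norm_cpow_eq_rpow_re_of_pos h0]
  have h1 : ‖((t - ⌊t⌋₊ : ℝ) : ℂ)‖ ≤ 1 := by
    simpa [sawtooth, indicator_of_mem ht] using norm_sawtooth_le t
  simpa using mul_le_mul_of_nonneg_left h1 (Real.rpow_nonneg h0.le _)

theorem differentiableAt_mellin_sawtooth {s : ℂ} (hs : s.re < 0) :
    DifferentiableAt ℂ (mellin sawtooth) s := by
  -- Boundedness at infinity gives exponent `0`; the sawtooth vanishes near `0`, so any exponent
  -- below `s.re` serves there.
  refine mellin_differentiableAt_of_isBigO_rpow (a := 0) (b := s.re - 1) ?_ ?_ hs ?_ (by linarith)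
  · refine LocallyIntegrable.locallyIntegrableOn ?_ _
    refine (locallyIntegrable_const (1 : ℝ)).mono measurable_sawtooth.aestronglyMeasurable ?_
    exact .of_forall fun t => by simpa using norm_sawtooth_le t
  · refine Asymptotics.IsBigO.of_bound 1 (.of_forall fun t => ?_)
    simpa using norm_sawtooth_le t
  · refine Asymptotics.IsBigO.of_bound 1 ?_
    filter_upwards [mem_nhdsWithin_of_mem_nhds (Iio_mem_nhds (zero_lt_one' ℝ))] with t ht
    have : t ∉ Ioi (1 : ℝ) := fun h => lt_asymm (mem_Ioi.1 h) (mem_Iio.1 ht)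
    simp [sawtooth, indicator_of_notMem this]

/-- For `Re s > 1` this is Abel summation with `⌊t⌋ = t - {t}`. Both sides are holomorphic in `Re s
> 0`, so the identity theorem extends it. -/
theorem riemannZeta₁_eq {s : ℂ} (hs : 0 < s.re) :
    riemannZeta₁ s = s - s * (s - 1) * mellin sawtooth (-s) := by
  have hU : IsOpen {s : ℂ | 0 < s.re} := isOpen_lt continuous_const continuous_re
  have hpre : IsPreconnected {s : ℂ | 0 < s.re} := (convex_halfSpace_re_gt 0).isPreconnected
  have h1 : AnalyticOnNhd ℂ riemannZeta₁ {s : ℂ | 0 < s.re} :=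
    differentiable_riemannZeta₁.differentiableOn.analyticOnNhd hU
  have h2 : AnalyticOnNhd ℂ (fun s => s - s * (s - 1) * mellin sawtooth (-s))
      {s : ℂ | 0 < s.re} := by
    refine DifferentiableOn.analyticOnNhd (fun s hs => ?_) hU
    have : DifferentiableAt ℂ (fun s => mellin sawtooth (-s)) s := by
      have h3 : DifferentiableAt ℂ (mellin sawtooth) (-s) :=
        differentiableAt_mellin_sawtooth (by simpa using hs)
      exact h3.comp s differentiableAt_id.neg
    exact (by fun_prop : DifferentiableAt ℂ _ s).differentiableWithinAt
  refine h1.eqOn_of_preconnected_of_eventuallyEq h2 hpre (z₀ := 2) (by simp) ?_ hs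
  filter_upwards [(isOpen_lt continuous_const continuous_re).mem_nhds
    (show (1 : ℝ) < (2 : ℂ).re by simp)] with z (hz : 1 < z.re)
  have hz1 : z - 1 ≠ 0 := fun h => by
    rw [sub_eq_zero] at h; simp [h] at hz
  have hz0 : z ≠ 0 := fun h => by simp [h] at hz; linarith
  have hL := LSeries_eq_mul_integral 1 (r := 1) zero_le_one hz (LSeriesSummable_one_iff.2 hz)
    (Asymptotics.IsBigO.of_bound 1 (.of_forall fun n => by simp))
  rw [LSeries_one_eq_riemannZeta hz, riemannZeta_eq_inv_sub_mul (sub_ne_zero.1 hz1)] at hL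
  have hpow : IntegrableOn (fun t : ℝ => (t : ℂ) ^ (-z)) (Ioi 1) :=
    integrableOn_Ioi_cpow_of_lt (by simpa using hz) one_pos
  have hsaw : IntegrableOn (fun t : ℝ => (t : ℂ) ^ (-z - 1) * ((t - ⌊t⌋₊ : ℝ) : ℂ)) (Ioi 1) := by
    have h3 : IntegrableOn (fun t : ℝ => (t : ℂ) ^ (-z - 1) * sawtooth t) (Ioi 1) := by
      refine Integrable.mul_bdd (c := 1) ?_ measurable_sawtooth.aestronglyMeasurable
        (.of_forall norm_sawtooth_le)
      exact integrableOn_Ioi_cpow_of_lt (by simp; linarith) one_pos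
    refine h3.congr_fun (fun t ht => ?_) measurableSet_Ioi
    simp [sawtooth, indicator_of_mem ht]
  have hI : ∫ t in Ioi (1 : ℝ), (∑ k ∈ Finset.Icc 1 ⌊t⌋₊, (1 : ℕ → ℂ) k) * (t : ℂ) ^ (-(z + 1))
      = 1 / (z - 1) - mellin sawtooth (-z) := by
    rw [mellin_sawtooth_eq]
    have h4 := integral_Ioi_cpow_of_lt (a := -z) (by simpa using hz) one_pos
    have h5 : ∫ t in Ioi (1 : ℝ), (t : ℂ) ^ (-z) = 1 / (z - 1) := by
      rw [h4]
      have : -z + 1 ≠ 0 := fun h => hz1 (by linear_combination -h)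
      simp only [ofReal_one, one_cpow]
      field_simp
      ring
    rw [← h5, ← integral_sub hpow hsaw]
    refine setIntegral_congr_fun measurableSet_Ioi fun t ht => ?_
    have ht0 : (t : ℂ) ≠ 0 := by
      have : (1 : ℝ) < t := ht
      exact_mod_cast (by linarith : t ≠ 0)
    have h6 : (t : ℂ) ^ (-z) = (t : ℂ) ^ (-z - 1) * t := by
      rw [cpow_sub _ _ ht0, cpow_one, div_mul_cancel₀ _ ht0]
    simp only [Pi.one_apply, Finset.sum_const, Nat.card_Icc, Nat.add_sub_cancel, nsmul_eq_mul, mul_one]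
    rw [h6, neg_add']
    push_cast
    ring
  rw [hI] at hL
  field_simp at hL
  linear_combination hL

/-- The sawtooth integral is at most `2` in the strip, leaving the quadratic factor `s(s - 1)`. The
constant is not sharp; only polynomial growth matters, to justify the contour shift. -/
theorem norm_riemannZeta₁_le {σ : ℝ} (hσ : σ ∈ Icc (1 / 2 : ℝ) 2) (t : ℝ) :
    ‖riemannZeta₁ (σ + t * I)‖ ≤ 14 * (1 + |t|) ^ 2 := by
  have hre : ((σ : ℂ) + t * I).re = σ := by simp
  rw [riemannZeta₁_eq (by rw [hre]; linarith [hσ.1])]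
  have h1 : ‖(σ : ℂ) + t * I‖ ≤ 2 * (1 + |t|) := by
    refine (norm_add_le _ _).trans ?_
    rw [norm_mul, norm_I, norm_real, norm_real, Real.norm_eq_abs, Real.norm_eq_abs, mul_one,
      abs_of_nonneg (by linarith [hσ.1])]
    linarith [hσ.2, abs_nonneg t]
  have h2 : ‖(σ : ℂ) + t * I - 1‖ ≤ 1 + |t| := by
    rw [show (σ : ℂ) + t * I - 1 = ((σ - 1 : ℝ) : ℂ) + t * I by push_cast; ring]
    refine (norm_add_le _ _).trans ?_
    rw [norm_mul, norm_I, norm_real, norm_real, Real.norm_eq_abs, Real.norm_eq_abs, mul_one]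
    have : |σ - 1| ≤ 1 := abs_le.2 ⟨by linarith [hσ.1], by linarith [hσ.2]⟩
    linarith
  have h3 : ‖mellin sawtooth (-(σ + t * I))‖ ≤ 2 := by
    refine (norm_mellin_sawtooth_le (by rw [hre]; linarith [hσ.1])).trans ?_
    rw [hre, div_le_iff₀ (by linarith [hσ.1])]
    linarith [hσ.1]
  have h4 : 1 + |t| ≤ (1 + |t|) ^ 2 := by nlinarith [abs_nonneg t]
  refine (norm_sub_le _ _).trans ?_
  rw [norm_mul, norm_mul]
  have h5 : ‖(σ : ℂ) + t * I‖ * ‖(σ : ℂ) + t * I - 1‖ * ‖mellin sawtooth (-(σ + t * I))‖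
      ≤ 2 * (1 + |t|) * (1 + |t|) * 2 := by gcongr
  nlinarith [sq_nonneg (1 + |t|)]

/-- Taylor expansion with holomorphic remainder. -/
theorem exists_taylor_remainder {F : ℂ → ℂ} {U : Set ℂ} {c : ℂ} (hU : U ∈ 𝓝 c)
    (hF : DifferentiableOn ℂ F U) (n : ℕ) :
    ∃ (q : ℕ → ℂ) (R : ℂ → ℂ), DifferentiableOn ℂ R U ∧
      ∀ s, F s = ∑ j ∈ Finset.range n, q j * (s - c) ^ j + (s - c) ^ n * R s := by
  induction n with
  | zero => exact ⟨0, F, hF, fun s => by simp⟩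
  | succ n ih =>
    obtain ⟨q, R, hR, h⟩ := ih
    refine ⟨fun j => if j = n then R c else q j, dslope R c,
      (Complex.differentiableOn_dslope hU).2 hR, fun s => ?_⟩
    have h1 : R s = R c + (s - c) * dslope R c s := by
      have := sub_smul_dslope R c s
      rw [smul_eq_mul] at this
      rw [this]; ring
    rw [h, Finset.sum_range_succ, h1, pow_succ]
    simp only [if_true]
    have h2 : ∑ j ∈ Finset.range n, (if j = n then R c else q j) * (s - c) ^ j
        = ∑ j ∈ Finset.range n, q j * (s - c) ^ j :=
      Finset.sum_congr rfl fun j hj => by rw [if_neg (Finset.mem_range.1 hj).ne]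
    rw [h2]
    ring

theorem divisorFunction_succ (k n : ℕ) :
    divisorFunction (k + 1) n = ∑ x ∈ n.divisorsAntidiagonal, divisorFunction k x.2 := by
  classical
  unfold divisorFunction
  rw [← Finset.card_sigma]
  refine Finset.card_bij' (fun f _ => ⟨(f 0, ∏ i, Fin.tail f i), Fin.tail f⟩)
    (fun p _ => Fin.cons p.1.1 p.2) ?_ ?_ ?_ ?_
  · intro f hf
    rw [Nat.mem_finMulAntidiag, Fin.prod_univ_succ] at hf
    simp only [Finset.mem_sigma, Nat.mem_divisorsAntidiagonal, Nat.mem_finMulAntidiag]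
    have : ∏ i, f (Fin.succ i) ≠ 0 := fun h => hf.2 (by rw [← hf.1, h, mul_zero])
    exact ⟨⟨hf.1, hf.2⟩, trivial, this⟩
  · rintro ⟨⟨a, b⟩, g⟩ h
    simp only [Finset.mem_sigma, Nat.mem_divisorsAntidiagonal, Nat.mem_finMulAntidiag] at h
    rw [Nat.mem_finMulAntidiag, Fin.prod_univ_succ]
    simp [h.2.1, h.1.1, h.1.2]
  · intro f hf
    exact Fin.cons_self_tail f
  · rintro ⟨⟨a, b⟩, g⟩ h
    simp only [Finset.mem_sigma, Nat.mem_divisorsAntidiagonal, Nat.mem_finMulAntidiag] at h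
    simp [h.2.1]

theorem divisorFunction_zero_left (n : ℕ) :
    divisorFunction 0 n = (1 : ArithmeticFunction ℕ) n := by
  unfold divisorFunction
  by_cases hn : n = 1
  · subst hn
    simp [Nat.finMulAntidiag_one]
  · rw [Nat.finMulAntidiag_zero_left hn, ArithmeticFunction.one_apply_ne hn]
    rfl

theorem zeta_pow_apply (k n : ℕ) :
    ((ArithmeticFunction.zeta : ArithmeticFunction ℂ) ^ k) n = divisorFunction k n := by
  induction k generalizing n with
  | zero =>
    rw [divisorFunction_zero_left, pow_zero, ArithmeticFunction.one_apply,
      ArithmeticFunction.one_apply]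
    split_ifs <;> simp
  | succ k ih =>
    rw [pow_succ', ArithmeticFunction.mul_apply, divisorFunction_succ, Nat.cast_sum]
    refine Finset.sum_congr rfl fun x hx => ?_
    have : x.1 ≠ 0 := by
      intro h
      rw [Nat.mem_divisorsAntidiagonal, h, zero_mul] at hx
      exact hx.2 hx.1.symm
    rw [ih, ArithmeticFunction.natCoe_apply, ArithmeticFunction.zeta_apply_ne this]
    simp

theorem LSeries_divisorFunction {s : ℂ} (hs : 1 < s.re) {k : ℕ} (hk : 1 ≤ k) :
    LSeriesSummable (fun n => (divisorFunction k n : ℂ)) s ∧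
      LSeries (fun n => (divisorFunction k n : ℂ)) s = riemannZeta s ^ k := by
  have h0 : ∀ k, (fun n => (divisorFunction k n : ℂ)) =
      fun n => ((ArithmeticFunction.zeta : ArithmeticFunction ℂ) ^ k) n :=
    fun k => funext fun n => (zeta_pow_apply k n).symm
  have hz : LSeriesSummable (fun n => (ArithmeticFunction.zeta : ArithmeticFunction ℂ) n) s := by
    simpa using ArithmeticFunction.LSeriesSummable_zeta_iff.2 hs
  have hz' : LSeries (fun n => (ArithmeticFunction.zeta : ArithmeticFunction ℂ) n) s
      = riemannZeta s := by
    simpa using ArithmeticFunction.LSeries_zeta_eq_riemannZeta hs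
  rw [h0]
  induction k, hk using Nat.le_induction with
  | base => simpa only [pow_one] using ⟨hz, hz'⟩
  | succ k _ ih =>
    rw [pow_succ]
    exact ⟨ArithmeticFunction.LSeriesSummable_mul ih.1 hz, by
      rw [ArithmeticFunction.LSeries_mul' ih.1 hz, ih.2, hz', pow_succ]⟩

end PiltzDivisor

end

/-! ### The residue as main term, and the Laplace transform of the error term. -/

noncomputable section

namespace PiltzDivisor

open Filter Topology MeasureTheory Complex Set

/-- `ζ(s)^k / s` has principal part `∑ q_j (s - 1)^(j - k)` at `s = 1` and holomorphic
remainder `R` in the right half-plane. -/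
structure IsPolarDecomposition (k : ℕ) (q : ℕ → ℂ) (R : ℂ → ℂ) : Prop where
  differentiableOn : DifferentiableOn ℂ R {s | 0 < s.re}
  eq : ∀ s, riemannZeta₁ s ^ k / s =
    ∑ j ∈ Finset.range k, q j * (s - 1) ^ j + (s - 1) ^ k * R s

theorem exists_isPolarDecomposition (k : ℕ) : ∃ q R, IsPolarDecomposition k q R := by
  have hU : {s : ℂ | 0 < s.re} ∈ 𝓝 (1 : ℂ) :=
    (isOpen_lt continuous_const continuous_re).mem_nhds (by simp)
  obtain ⟨q, R, h1, h2⟩ := exists_taylor_remainder (F := fun s => riemannZeta₁ s ^ k / s) hU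
    (DifferentiableOn.div (by fun_prop) differentiableOn_id fun s (hs : 0 < s.re) (h : s = 0) => by
      rw [h, zero_re] at hs
      exact lt_irrefl _ hs) k
  exact ⟨q, R, h1, h2⟩

/-- The exponent `k - j` is written as `m + 1` with `m = k - 1 - j`, to match both Cauchy's formula
for an `m`-th derivative and the Laplace transform `m!/w^(m+1)` of `v^m`. -/
theorem IsPolarDecomposition.zeta_pow_div {k : ℕ} {q : ℕ → ℂ} {R : ℂ → ℂ}
    (h : IsPolarDecomposition k q R) {s : ℂ} (hs : s ≠ 1) :
    riemannZeta s ^ k / s =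
      ∑ j ∈ Finset.range k, q j * (1 / (s - 1) ^ (k - 1 - j + 1)) + R s := by
  have h1 : s - 1 ≠ 0 := sub_ne_zero.2 hs
  have h2 : riemannZeta s ^ k / s = (riemannZeta₁ s ^ k / s) / (s - 1) ^ k := by
    rw [riemannZeta_eq_inv_sub_mul hs, mul_pow, inv_pow]
    field_simp
  rw [h2, h.eq, add_div, mul_div_cancel_left₀ _ (pow_ne_zero _ h1), Finset.sum_div]
  congr 1
  refine Finset.sum_congr rfl fun j hj => ?_
  have hj' := Finset.mem_range.1 hj
  have h3 : (s - 1) ^ k = (s - 1) ^ j * (s - 1) ^ (k - 1 - j + 1) := by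
    rw [← pow_add]; congr 1; omega
  rw [h3]
  field_simp

/-- The polynomial main term attached to the principal part `q`. -/
def mainTerm (k : ℕ) (q : ℕ → ℂ) (x : ℝ) : ℂ :=
  ∑ j ∈ Finset.range k, q j * ((x * Real.log x ^ (k - 1 - j) : ℝ) / ((k - 1 - j).factorial : ℂ))

/-- On circles of radius below `1/2` the part from `R` integrates to zero, and each polar term gives
a Taylor coefficient of `x^s` at `1`, namely `x (log x)^m / m!`. The circle integral is thus
constant for small radii. -/
theorem residue_eq_mainTerm {k : ℕ} {q : ℕ → ℂ} {R : ℂ → ℂ} (h : IsPolarDecomposition k q R)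
    {x : ℝ} (hx : 0 < x) :
    residue (fun s : ℂ => riemannZeta s ^ k * (x : ℂ) ^ s / s) 1 = mainTerm k q x := by
  have hx0 : (x : ℂ) ≠ 0 := by exact_mod_cast hx.ne'
  have hpowd : Differentiable ℂ fun s : ℂ => (x : ℂ) ^ s := fun s =>
    differentiableAt_id.const_cpow (Or.inl hx0)
  have hiter : ∀ n, iteratedDeriv n (fun s : ℂ => (x : ℂ) ^ s) 1 =
      ((x * Real.log x ^ n : ℝ) : ℂ) := by
    intro n
    have : (fun s : ℂ => (x : ℂ) ^ s) = fun s => cexp (Complex.log x * s) := by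
      funext s; rw [cpow_def_of_ne_zero hx0]
    rw [this, iteratedDeriv_cexp_const_mul]
    simp only [mul_one]
    rw [Complex.exp_log hx0, ← Complex.ofReal_log hx.le]
    push_cast
    ring
  refine Tendsto.limUnder_eq (tendsto_const_nhds.congr' ?_)
  filter_upwards [Ioo_mem_nhdsGT (show (0 : ℝ) < 1 / 2 by norm_num)] with r hr
  have hball : Metric.closedBall (1 : ℂ) r ⊆ {s | 0 < s.re} := by
    intro s hs
    rw [Metric.mem_closedBall, dist_eq_norm] at hs
    have h1 := (abs_re_le_norm (s - 1)).trans hs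
    rw [sub_re, one_re, abs_le] at h1
    show 0 < s.re
    linarith [hr.2]
  have hsph : ∀ z ∈ Metric.sphere (1 : ℂ) r, z ≠ 1 := fun z hz h1 => by
    rw [h1, Metric.mem_sphere, dist_self] at hz
    exact hr.1.ne hz
  have hRx : DifferentiableOn ℂ (fun z => R z * (x : ℂ) ^ z) (Metric.closedBall 1 r) :=
    (h.differentiableOn.mono hball).mul hpowd.differentiableOn
  have hcongr : EqOn (fun s : ℂ => riemannZeta s ^ k * (x : ℂ) ^ s / s)
      (fun z => ∑ j ∈ Finset.range k, q j * ((1 / (z - 1) ^ (k - 1 - j + 1)) • (x : ℂ) ^ z)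
        + R z * (x : ℂ) ^ z) (Metric.sphere 1 r) := by
    intro z hz
    simp only [smul_eq_mul]
    rw [mul_div_right_comm, h.zeta_pow_div (hsph z hz), add_mul, Finset.sum_mul]
    simp only [mul_assoc]
  have hc : ∀ j ∈ Finset.range k, CircleIntegrable
      (fun z => q j * ((1 / (z - 1) ^ (k - 1 - j + 1)) • (x : ℂ) ^ z)) 1 r := by
    intro j _
    refine ContinuousOn.circleIntegrable hr.1.le ?_
    refine continuousOn_const.mul (ContinuousOn.fun_smul ?_ hpowd.continuous.continuousOn)
    exact continuousOn_const.div (by fun_prop)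
      fun z hz => pow_ne_zero _ (sub_ne_zero.2 (hsph z hz))
  have hcR : CircleIntegrable (fun z => R z * (x : ℂ) ^ z) 1 r :=
    (hRx.continuousOn.mono Metric.sphere_subset_closedBall).circleIntegrable hr.1.le
  have hsum : CircleIntegrable (fun z => ∑ j ∈ Finset.range k,
      q j * ((1 / (z - 1) ^ (k - 1 - j + 1)) • (x : ℂ) ^ z)) 1 r := by
    have := CircleIntegrable.sum (Finset.range k) hc
    convert this using 1
    funext z
    simp
  rw [circleIntegral.integral_congr hr.1.le hcongr, circleIntegral.integral_add hsum hcR,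
    circleIntegral.integral_fun_sum hc,
    Complex.circleIntegral_eq_zero_of_differentiable_on_off_countable hr.1.le countable_empty
      hRx.continuousOn fun z hz => (hRx.differentiableAt
        (Metric.closedBall_mem_nhds_of_mem hz.1)), add_zero, Finset.mul_sum, mainTerm]
  refine Finset.sum_congr rfl fun j _ => ?_
  rw [circleIntegral.integral_const_mul,
    DifferentiableOn.circleIntegral_one_div_sub_center_pow_smul hr.1 _ hpowd.differentiableOn,
    hiter, smul_eq_mul]
  have h2 : 2 * (Real.pi : ℂ) * I ≠ 0 := by
    simp [Real.pi_ne_zero]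
  field_simp

theorem integrableOn_pow_mul_cexp {w : ℂ} (hw : 0 < w.re) (m : ℕ) :
    IntegrableOn (fun v : ℝ => (v : ℂ) ^ m * cexp (-w * v)) (Ioi 0) := by
  have h := integrableOn_rpow_mul_exp_neg_mul_rpow (p := 1) (s := m) (b := w.re)
    (by linarith [m.cast_nonneg (α := ℝ)]) one_pos hw
  refine Integrable.mono' h (by fun_prop) ?_
  refine (ae_restrict_mem measurableSet_Ioi).mono fun v hv => ?_
  have hv0 : (0 : ℝ) < v := hv
  rw [norm_mul, norm_pow, norm_exp, norm_real, Real.norm_eq_abs, abs_of_pos hv0]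
  simp

/-- Induction on `m`: the derivative of `v^(m+1) e^{-wv}` integrates to zero over the half-line. -/
theorem integral_pow_mul_cexp {w : ℂ} (hw : 0 < w.re) (m : ℕ) :
    ∫ v in Ioi (0 : ℝ), (v : ℂ) ^ m * cexp (-w * v) = m.factorial / w ^ (m + 1) := by
  have hw0 : w ≠ 0 := fun h => by simp [h] at hw
  induction m with
  | zero =>
    have := integral_exp_mul_complex_Ioi (a := -w) (by simpa using hw) 0
    simp only [pow_zero, one_mul, this]
    simp
  | succ m ih =>
    have hd : ∀ v ∈ Ioi (0 : ℝ), HasDerivAt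
        (fun v : ℝ => (v : ℂ) ^ (m + 1) * cexp (-w * v))
        ((m + 1) * ((v : ℂ) ^ m * cexp (-w * v)) - w * ((v : ℂ) ^ (m + 1) * cexp (-w * v))) v := by
      intro v _
      have h1 : HasDerivAt (fun z : ℂ => z ^ (m + 1) * cexp (-w * z))
          ((m + 1) * ((v : ℂ) ^ m * cexp (-w * v)) - w * ((v : ℂ) ^ (m + 1) * cexp (-w * v)))
          (v : ℂ) := by
        have h2 := (hasDerivAt_pow (m + 1) (v : ℂ)).mul
          (((hasDerivAt_id (v : ℂ)).const_mul (-w)).cexp)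
        refine h2.congr_deriv ?_
        push_cast
        simp only [id, mul_one]
        ring
      exact h1.comp_ofReal
    have hi := ((integrableOn_pow_mul_cexp hw m).const_mul (m + 1 : ℂ)).sub
      ((integrableOn_pow_mul_cexp hw (m + 1)).const_mul w)
    have ht : Tendsto (fun v : ℝ => (v : ℂ) ^ (m + 1) * cexp (-w * v)) atTop (𝓝 0) := by
      rw [tendsto_zero_iff_norm_tendsto_zero]
      refine (tendsto_rpow_mul_exp_neg_mul_atTop_nhds_zero ((m + 1 : ℕ) : ℝ) w.re hw).congr' ?_
      filter_upwards [eventually_gt_atTop 0] with v hv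
      rw [norm_mul, norm_pow, norm_exp, norm_real, Real.norm_eq_abs, abs_of_pos hv,
        Real.rpow_natCast]
      simp
    have h := integral_Ioi_of_hasDerivAt_of_tendsto
      (Continuous.continuousWithinAt (by fun_prop)) hd hi ht
    rw [integral_sub ((integrableOn_pow_mul_cexp hw m).const_mul _)
      ((integrableOn_pow_mul_cexp hw (m + 1)).const_mul w), integral_const_mul,
      integral_const_mul, ih] at h
    simp only [ofReal_zero, ne_eq, Nat.succ_ne_zero, not_false_eq_true, zero_pow, zero_mul,
      sub_zero] at h
    rw [Nat.factorial_succ, eq_div_iff (pow_ne_zero _ hw0)]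
    have h3 : w * ∫ v in Ioi (0 : ℝ), (v : ℂ) ^ (m + 1) * cexp (-w * v) =
        (m + 1) * (m.factorial / w ^ (m + 1)) := by linear_combination -h
    rw [pow_succ, mul_comm (w ^ (m + 1)), ← mul_assoc, mul_comm _ w, h3]
    push_cast
    field_simp

theorem mainTerm_exp_mul_cexp (k : ℕ) (q : ℕ → ℂ) (s : ℂ) (v : ℝ) :
    mainTerm k q (Real.exp v) * cexp (-s * v) = ∑ j ∈ Finset.range k,
      q j / ((k - 1 - j).factorial : ℂ) * ((v : ℂ) ^ (k - 1 - j) * cexp (-(s - 1) * v)) := by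
  rw [mainTerm, Finset.sum_mul]
  refine Finset.sum_congr rfl fun j _ => ?_
  have : cexp (-(s - 1) * v) = cexp v * cexp (-s * v) := by
    rw [← Complex.exp_add]; congr 1; ring
  rw [Real.log_exp, this]
  push_cast
  ring

theorem integrableOn_mainTerm_exp (k : ℕ) (q : ℕ → ℂ) {s : ℂ} (hs : 1 < s.re) :
    IntegrableOn (fun v : ℝ => mainTerm k q (Real.exp v) * cexp (-s * v)) (Ioi 0) := by
  simp_rw [mainTerm_exp_mul_cexp]
  exact integrable_finsetSum _ fun j _ =>
    (integrableOn_pow_mul_cexp (by simpa using hs) _).const_mul _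

theorem integral_mainTerm_exp (k : ℕ) (q : ℕ → ℂ) {s : ℂ} (hs : 1 < s.re) :
    ∫ v in Ioi (0 : ℝ), mainTerm k q (Real.exp v) * cexp (-s * v) =
      ∑ j ∈ Finset.range k, q j * (1 / (s - 1) ^ (k - 1 - j + 1)) := by
  have hs' : 0 < (s - 1).re := by simpa using hs
  simp_rw [mainTerm_exp_mul_cexp]
  rw [integral_finsetSum _ fun j _ => (integrableOn_pow_mul_cexp hs' _).const_mul _]
  refine Finset.sum_congr rfl fun j _ => ?_
  rw [integral_const_mul, integral_pow_mul_cexp hs']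
  have : ((k - 1 - j).factorial : ℂ) ≠ 0 := by exact_mod_cast Nat.factorial_ne_zero _
  field_simp

/-- The summatory function of `d_k`. -/
def divisorSum (k : ℕ) (x : ℝ) : ℝ := ∑ n ∈ Finset.Icc 1 ⌊x⌋₊, (divisorFunction k n : ℝ)

theorem monotone_divisorSum (k : ℕ) : Monotone (divisorSum k) := fun _ _ hxy =>
  Finset.sum_le_sum_of_subset_of_nonneg (Finset.Icc_subset_Icc_right (Nat.floor_mono hxy))
    fun _ _ _ => Nat.cast_nonneg _

theorem divisorSum_nonneg (k : ℕ) (x : ℝ) : 0 ≤ divisorSum k x :=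
  Finset.sum_nonneg fun _ _ => Nat.cast_nonneg _

/-- Rankin's trick: `1 ≤ (x/n)^(3/2)` for `n ≤ x`, and the Dirichlet series converges at `3/2`. The
exponent only has to lie below `2`, the abscissa of the inversion line. -/
theorem exists_divisorSum_le {k : ℕ} (hk : 1 ≤ k) :
    ∃ C : ℝ, 0 ≤ C ∧ ∀ x : ℝ, 0 ≤ x → divisorSum k x ≤ C * x ^ (3 / 2 : ℝ) := by
  have hs : LSeriesSummable (fun n => (divisorFunction k n : ℂ)) (3 / 2 : ℝ) :=
    (LSeries_divisorFunction (by rw [ofReal_re]; norm_num) hk).1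
  have hs' := hs.norm
  refine ⟨∑' n, ‖LSeries.term (fun n => (divisorFunction k n : ℂ)) (3 / 2 : ℝ) n‖,
    tsum_nonneg fun _ => norm_nonneg _, fun x hx => ?_⟩
  have h1 : ∀ n ∈ Finset.Icc 1 ⌊x⌋₊, (divisorFunction k n : ℝ) ≤
      ‖LSeries.term (fun n => (divisorFunction k n : ℂ)) (3 / 2 : ℝ) n‖ * x ^ (3 / 2 : ℝ) := by
    intro n hn
    rw [Finset.mem_Icc] at hn
    have hn0 : (0 : ℝ) < n := by exact_mod_cast hn.1
    have hnx : (n : ℝ) ≤ x := (Nat.le_floor_iff hx).1 hn.2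
    rw [LSeries.norm_term_eq, if_neg (by omega), ofReal_re, div_mul_eq_mul_div,
      le_div_iff₀ (by positivity)]
    rw [norm_natCast]
    gcongr
  refine (Finset.sum_le_sum h1).trans ?_
  rw [← Finset.sum_mul]
  gcongr
  exact hs'.sum_le_tsum _ fun _ _ => norm_nonneg _

theorem integrableOn_divisorSum_exp {k : ℕ} (hk : 1 ≤ k) {s : ℂ} (hs : 3 / 2 < s.re) :
    IntegrableOn (fun v : ℝ => (divisorSum k (Real.exp v) : ℂ) * cexp (-s * v)) (Ioi 0) := by
  obtain ⟨C, hC, hle⟩ := exists_divisorSum_le hk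
  have hi := (integrableOn_exp_mul_Ioi (a := 3 / 2 - s.re) (by linarith) 0).const_mul C
  have hm : Measurable fun v : ℝ => divisorSum k (Real.exp v) :=
    ((monotone_divisorSum k).comp Real.exp_monotone).measurable
  refine Integrable.mono' hi ?_ (.of_forall fun v => ?_)
  · exact ((Complex.measurable_ofReal.comp hm).mul (by fun_prop)).aestronglyMeasurable
  · rw [norm_mul, norm_real, Real.norm_eq_abs, abs_of_nonneg (divisorSum_nonneg _ _), norm_exp]
    have h1 := hle _ (Real.exp_pos v).le
    rw [← Real.exp_mul] at h1
    calc _ ≤ C * Real.exp (v * (3 / 2)) * Real.exp (-s * v).re := by gcongr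
      _ = C * Real.exp ((3 / 2 - s.re) * v) := by
        rw [mul_assoc, ← Real.exp_add]
        congr 2
        simp
        ring

/-- Abel summation of the Dirichlet series, followed by `t = e^v`, whose Jacobian cancels one power
of `t`. -/
theorem integral_divisorSum_exp {k : ℕ} (hk : 1 ≤ k) {s : ℂ} (hs : 3 / 2 < s.re) :
    ∫ v in Ioi (0 : ℝ), (divisorSum k (Real.exp v) : ℂ) * cexp (-s * v) =
      riemannZeta s ^ k / s := by
  obtain ⟨C, hC, hle⟩ := exists_divisorSum_le hk
  obtain ⟨h1, h2⟩ := LSeries_divisorFunction (s := s) (by linarith) hk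
  have hs0 : s ≠ 0 := fun h => by simp [h] at hs; linarith
  have hO : (fun n : ℕ => ∑ m ∈ Finset.Icc 1 n, (divisorFunction k m : ℂ)) =O[atTop]
      fun n : ℕ => (n : ℝ) ^ (3 / 2 : ℝ) := by
    refine Asymptotics.IsBigO.of_bound C (.of_forall fun n => ?_)
    have := hle n n.cast_nonneg
    rw [divisorSum, Nat.floor_natCast] at this
    rw [Real.norm_of_nonneg (by positivity)]
    refine le_trans ?_ this
    refine (norm_sum_le _ _).trans (le_of_eq ?_)
    simp
  have h3 := LSeries_eq_mul_integral _ (by norm_num : (0 : ℝ) ≤ 3 / 2) hs h1 hO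
  rw [h2] at h3
  rw [h3, mul_div_cancel_left₀ _ hs0]
  have h4 := integral_image_eq_integral_abs_deriv_smul (s := Ioi (0 : ℝ)) measurableSet_Ioi
    (fun v _ => (Real.hasDerivAt_exp v).hasDerivWithinAt) Real.exp_injective.injOn
    (fun t : ℝ => (∑ m ∈ Finset.Icc 1 ⌊t⌋₊, (divisorFunction k m : ℂ)) * (t : ℂ) ^ (-(s + 1)))
  rw [Real.image_exp_Ioi, Real.exp_zero] at h4
  rw [h4]
  congr with v
  have h5 : (Real.exp v : ℂ) ^ (-(s + 1)) = cexp (-s * v) * cexp (-v) := by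
    rw [cpow_def_of_ne_zero (by exact_mod_cast (Real.exp_pos v).ne'),
      ← ofReal_log (Real.exp_pos v).le, Real.log_exp, ← Complex.exp_add]
    congr 1
    ring
  rw [h5, abs_of_pos (Real.exp_pos v), real_smul, divisorSum]
  push_cast
  have h6 : cexp v * cexp (-v) = 1 := by rw [← Complex.exp_add]; simp
  linear_combination -(∑ m ∈ Finset.Icc 1 ⌊Real.exp v⌋₊, (divisorFunction k m : ℂ)) *
    cexp (-s * v) * h6

/-- The error term in the logarithmic variable, cut off to `v > 0`. -/
def logError (k : ℕ) (q : ℕ → ℂ) : ℝ → ℂ :=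
  indicator (Ioi 0) fun v => divisorSum k (Real.exp v) - mainTerm k q (Real.exp v)

theorem logError_mul (k : ℕ) (q : ℕ → ℂ) (s : ℂ) (v : ℝ) : logError k q v * cexp (-s * v) =
    indicator (Ioi 0) (fun v : ℝ => divisorSum k (Real.exp v) * cexp (-s * v) -
      mainTerm k q (Real.exp v) * cexp (-s * v)) v := by
  unfold logError
  by_cases hv : v ∈ Ioi (0 : ℝ)
  · rw [indicator_of_mem hv, indicator_of_mem hv]; ring
  · rw [indicator_of_notMem hv, indicator_of_notMem hv, zero_mul]

theorem integrable_logError {k : ℕ} (hk : 1 ≤ k) (q : ℕ → ℂ) {s : ℂ} (hs : 3 / 2 < s.re) :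
    Integrable fun v : ℝ => logError k q v * cexp (-s * v) := by
  simp_rw [logError_mul]
  rw [integrable_indicator_iff measurableSet_Ioi]
  exact (integrableOn_divisorSum_exp hk hs).sub (integrableOn_mainTerm_exp k q (by linarith))

/-- The transform of the main term over `v > 0` is exactly the principal part of `ζ^k / s`, so only
the holomorphic remainder survives. -/
theorem integral_logError {k : ℕ} (hk : 1 ≤ k) {q : ℕ → ℂ} {R : ℂ → ℂ}
    (h : IsPolarDecomposition k q R) {s : ℂ} (hs : 3 / 2 < s.re) :
    ∫ v : ℝ, logError k q v * cexp (-s * v) = R s := by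
  have hs1 : s ≠ 1 := fun h => by rw [h, one_re] at hs; linarith
  simp_rw [logError_mul]
  rw [integral_indicator measurableSet_Ioi, integral_sub (integrableOn_divisorSum_exp hk hs)
    (integrableOn_mainTerm_exp k q (by linarith)), integral_divisorSum_exp hk hs,
    integral_mainTerm_exp k q (by linarith), h.zeta_pow_div hs1]
  ring

theorem continuous_mainTerm_exp (k : ℕ) (q : ℕ → ℂ) :
    Continuous fun v : ℝ => mainTerm k q (Real.exp v) := by
  simp only [mainTerm, Real.log_exp]
  fun_prop

/-- A monotone function has countably many jumps and the main term is continuous, so pointwise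
inversion is available almost everywhere. -/
theorem countable_not_continuousAt_logError (k : ℕ) (q : ℕ → ℂ) :
    {v | ¬ ContinuousAt (logError k q) v}.Countable := by
  have h1 := ((monotone_divisorSum k).comp Real.exp_monotone).countable_not_continuousAt
  refine (h1.union (countable_singleton (0 : ℝ))).mono fun v hv => ?_
  by_contra hcon
  simp only [mem_union, mem_ofPred_eq, mem_singleton_iff, not_or, not_not] at hcon
  obtain ⟨hc, hv0⟩ := hcon
  refine hv ?_
  rcases lt_or_gt_of_ne hv0 with hlt | hgt
  · have h0 : logError k q =ᶠ[𝓝 v] fun _ => 0 := by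
      filter_upwards [Iio_mem_nhds hlt] with u hu
      have hu' : u ∉ Ioi (0 : ℝ) := fun h => lt_asymm (mem_Ioi.1 h) (mem_Iio.1 hu)
      rw [logError, indicator_of_notMem hu']
    exact continuousAt_const.congr h0.symm
  · have h2 : ContinuousAt (fun v : ℝ => (divisorSum k (Real.exp v) : ℂ) -
        mainTerm k q (Real.exp v)) v :=
      (continuous_ofReal.continuousAt.comp hc).sub (continuous_mainTerm_exp k q).continuousAt
    refine h2.congr ?_
    filter_upwards [Ioi_mem_nhds hgt] with u hu
    rw [logError, indicator_of_mem (show u ∈ Ioi (0 : ℝ) from hu)]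

end PiltzDivisor

end

/-! ### Bounds for the transform, and the mean square of proportional differences. -/

noncomputable section

namespace PiltzDivisor

open Filter Topology MeasureTheory Complex Set

/-- Compactness handles `|t| ≤ 1`, near the removed pole; for `|t| > 1` both `|s|` and `|s - 1|` are
at least `1`, and the bound for zeta applies. -/
theorem IsPolarDecomposition.exists_norm_le {k : ℕ} {q : ℕ → ℂ} {R : ℂ → ℂ}
    (h : IsPolarDecomposition k q R) :
    ∃ C : ℝ, 0 ≤ C ∧ ∀ σ ∈ Icc (1 / 2 : ℝ) 2, ∀ t : ℝ,
      ‖R (σ + t * I)‖ ≤ C * (1 + |t|) ^ (2 * k) := by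
  have hK : IsCompact (Icc (1 / 2 : ℝ) 2 ×ˢ Icc (-1 : ℝ) 1) := isCompact_Icc.prod isCompact_Icc
  obtain ⟨M, hM⟩ := hK.exists_bound_of_continuousOn (f := fun p : ℝ × ℝ => R (p.1 + p.2 * I)) (by
    refine h.differentiableOn.continuousOn.comp (by fun_prop) fun p hp => ?_
    have : (1 / 2 : ℝ) ≤ p.1 := hp.1.1
    show 0 < ((p.1 : ℂ) + p.2 * I).re
    simp
    linarith)
  have hM0 : 0 ≤ M := (norm_nonneg _).trans (hM (1, 0) (by constructor <;> simp; norm_num))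
  refine ⟨max M (14 ^ k + ∑ j ∈ Finset.range k, ‖q j‖), le_max_of_le_left hM0,
    fun σ hσ t => ?_⟩
  have h1 : 1 ≤ (1 + |t|) ^ (2 * k) := one_le_pow₀ (by linarith [abs_nonneg t])
  rcases le_or_gt |t| 1 with ht | ht
  · calc ‖R (σ + t * I)‖ ≤ M := hM (σ, t) ⟨hσ, abs_le.1 ht⟩
      _ ≤ max M (14 ^ k + ∑ j ∈ Finset.range k, ‖q j‖) * 1 := by
          rw [mul_one]; exact le_max_left _ _
      _ ≤ _ := by gcongr
  · set s : ℂ := σ + t * I with hs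
    have him : s.im = t := by simp [hs]
    have hs1 : s ≠ 1 := fun h => by
      rw [h, one_im] at him; rw [← him, abs_zero] at ht; linarith
    have hn1 : 1 ≤ ‖s - 1‖ := by
      have := abs_im_le_norm (s - 1)
      rw [sub_im, him, one_im, sub_zero] at this
      linarith
    have hn0 : 1 ≤ ‖s‖ := by
      have := abs_im_le_norm s
      rw [him] at this
      linarith
    have hz : ‖riemannZeta s‖ ≤ 14 * (1 + |t|) ^ 2 := by
      rw [riemannZeta_eq_inv_sub_mul hs1, norm_mul, norm_inv]
      calc _ ≤ 1 * ‖riemannZeta₁ s‖ := by gcongr; exact inv_le_one_of_one_le₀ hn1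
        _ ≤ _ := by rw [one_mul]; exact norm_riemannZeta₁_le hσ t
    have hR : R s = riemannZeta s ^ k / s -
        ∑ j ∈ Finset.range k, q j * (1 / (s - 1) ^ (k - 1 - j + 1)) := by
      rw [h.zeta_pow_div hs1]; ring
    have hA : ‖riemannZeta s ^ k / s‖ ≤ 14 ^ k * (1 + |t|) ^ (2 * k) := by
      rw [norm_div, norm_pow]
      refine (div_le_self (by positivity) hn0).trans ?_
      calc _ ≤ (14 * (1 + |t|) ^ 2) ^ k := by gcongr
        _ = _ := by rw [mul_pow, ← pow_mul]
    have hB : ‖∑ j ∈ Finset.range k, q j * (1 / (s - 1) ^ (k - 1 - j + 1))‖ ≤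
        ∑ j ∈ Finset.range k, ‖q j‖ := by
      refine norm_sum_le_of_le _ fun j _ => ?_
      rw [norm_mul, norm_div, norm_one, norm_pow]
      refine mul_le_of_le_one_right (norm_nonneg _) ?_
      rw [div_le_one (by positivity)]
      exact one_le_pow₀ hn1
    rw [hR]
    have hS : 0 ≤ ∑ j ∈ Finset.range k, ‖q j‖ := Finset.sum_nonneg fun _ _ => norm_nonneg _
    calc _ ≤ 14 ^ k * (1 + |t|) ^ (2 * k) + ∑ j ∈ Finset.range k, ‖q j‖ :=
          (norm_sub_le _ _).trans (add_le_add hA hB)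
      _ ≤ (14 ^ k + ∑ j ∈ Finset.range k, ‖q j‖) * (1 + |t|) ^ (2 * k) := by nlinarith
      _ ≤ _ := by gcongr; exact le_max_right _ _

/-- Makes the asymptotic bound uniform: bounded `t` by continuity, negative `t` by conjugation. -/
theorem LindelofHypothesis.exists_norm_riemannZeta_le (hLH : LindelofHypothesis) {η : ℝ}
    (hη : 0 < η) :
    ∃ C : ℝ, 0 ≤ C ∧ ∀ t : ℝ, ‖riemannZeta (1 / 2 + t * I)‖ ≤ C * (1 + |t|) ^ η := by
  obtain ⟨c, hc⟩ := (hLH η hη).bound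
  obtain ⟨T, hT⟩ := eventually_atTop.1 hc
  have hcont : Continuous fun t : ℝ => riemannZeta (1 / 2 + t * I) := by
    refine continuous_iff_continuousAt.2 fun t => ?_
    have h1 : (1 / 2 + t * I : ℂ) ≠ 1 := fun h => by
      have := congrArg Complex.re h
      norm_num at this
    exact ContinuousAt.comp (f := fun t : ℝ => (1 / 2 + t * I : ℂ))
      (differentiableAt_riemannZeta h1).continuousAt (by fun_prop)
  obtain ⟨M, hM⟩ := (isCompact_Icc (a := 0) (b := max T 0)).exists_bound_of_continuousOn
    hcont.continuousOn
  have hM0 : 0 ≤ M := (norm_nonneg _).trans (hM 0 ⟨le_rfl, le_max_right _ _⟩)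
  have hpos : ∀ t : ℝ, 0 ≤ t → ‖riemannZeta (1 / 2 + t * I)‖ ≤ max M |c| * (1 + t) ^ η := by
    intro t ht
    rcases le_or_gt t (max T 0) with h | h
    · calc _ ≤ M := hM t ⟨ht, h⟩
        _ ≤ max M |c| * 1 := by rw [mul_one]; exact le_max_left _ _
        _ ≤ _ := by gcongr; exact Real.one_le_rpow (by linarith) hη.le
    · calc _ ≤ c * ‖t ^ η‖ := hT t ((le_max_left _ _).trans h.le)
        _ ≤ |c| * t ^ η := by
          rw [Real.norm_of_nonneg (by positivity)]; gcongr; exact le_abs_self c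
        _ ≤ _ := by gcongr; exacts [le_max_right _ _, by linarith]
  refine ⟨max M |c|, le_max_of_le_left hM0, fun t => ?_⟩
  rcases le_total 0 t with ht | ht
  · rw [abs_of_nonneg ht]; exact hpos t ht
  · rw [abs_of_nonpos ht]
    have h1 := hpos (-t) (by linarith)
    have h2 : (1 / 2 + ((-t : ℝ) : ℂ) * I) = (starRingEnd ℂ) (1 / 2 + t * I) := by
      have h3 : (starRingEnd ℂ) (1 / 2) = 1 / 2 := by
        rw [show (1 / 2 : ℂ) = ((1 / 2 : ℝ) : ℂ) by push_cast; rfl, conj_ofReal]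
      rw [map_add, h3]
      simp
    rwa [h2, riemannZeta_conj, norm_conj] at h1

theorem one_add_abs_le_three_mul_norm {s : ℂ} (hs : |s.re| = 1 / 2) : 1 + |s.im| ≤ 3 * ‖s‖ := by
  have h1 := abs_re_le_norm s
  have h2 := abs_im_le_norm s
  rw [hs] at h1
  linarith

/-- The Lindelöf bound with exponent `η/k` costs `η` after the `k`-th power, and `1/s` saves a full
power. In each polar term one factor `1/|s - 1|` supplies the decay and the others are at most `2`.
-/
theorem IsPolarDecomposition.exists_norm_le_half {k : ℕ} {q : ℕ → ℂ} {R : ℂ → ℂ}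
    (h : IsPolarDecomposition k q R) (hLH : LindelofHypothesis) (hk : 1 ≤ k) {η : ℝ} (hη : 0 < η) :
    ∃ C : ℝ, 0 ≤ C ∧ ∀ t : ℝ, ‖R (1 / 2 + t * I)‖ ≤ C * (1 + |t|) ^ (η - 1) := by
  have hk0 : (0 : ℝ) < k := by exact_mod_cast hk
  obtain ⟨c, hc0, hc⟩ := hLH.exists_norm_riemannZeta_le (div_pos hη hk0)
  refine ⟨c ^ k * 3 + ∑ j ∈ Finset.range k, ‖q j‖ * (2 ^ (k - 1 - j) * 3), by positivity,
    fun t => ?_⟩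
  set s : ℂ := 1 / 2 + t * I with hs
  have hre : s.re = 1 / 2 := by simp [hs]
  have him : s.im = t := by simp [hs]
  have hs1 : s ≠ 1 := fun h => by rw [h] at hre; norm_num at hre
  have hpos : 0 < 1 + |t| := by positivity
  have h0 : 1 / ‖s‖ ≤ 3 / (1 + |t|) := by
    have := one_add_abs_le_three_mul_norm (s := s) (by rw [hre]; norm_num)
    rw [him] at this
    rw [div_le_div_iff₀ (by linarith) hpos]
    linarith
  have hsub : |(s - 1).re| = 1 / 2 := by rw [sub_re, hre, one_re]; norm_num [abs_of_neg]
  have h1 : 1 / ‖s - 1‖ ≤ 3 / (1 + |t|) := by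
    have := one_add_abs_le_three_mul_norm hsub
    rw [sub_im, him, one_im, sub_zero] at this
    rw [div_le_div_iff₀ (by linarith) hpos]
    linarith
  have h1' : 1 / ‖s - 1‖ ≤ 2 := by
    have := abs_re_le_norm (s - 1)
    rw [hsub] at this
    rw [div_le_iff₀ (by linarith)]
    linarith
  have hrp : (1 + |t|) ^ (η - 1) = (1 + |t|) ^ η / (1 + |t|) := by
    rw [Real.rpow_sub hpos, Real.rpow_one]
  have hge : 1 ≤ (1 + |t|) ^ η := Real.one_le_rpow (by linarith [abs_nonneg t]) hη.le
  have hR : R s = riemannZeta s ^ k / s -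
      ∑ j ∈ Finset.range k, q j * (1 / (s - 1) ^ (k - 1 - j + 1)) := by
    rw [h.zeta_pow_div hs1]; ring
  have hA : ‖riemannZeta s ^ k / s‖ ≤ c ^ k * 3 * (1 + |t|) ^ (η - 1) := by
    rw [norm_div, norm_pow, div_eq_mul_one_div]
    calc _ ≤ (c * (1 + |t|) ^ (η / k)) ^ k * (3 / (1 + |t|)) := by
          gcongr
          exact hc t
      _ = _ := by
          rw [mul_pow, ← Real.rpow_natCast ((1 + |t|) ^ (η / k)), ← Real.rpow_mul hpos.le,
            div_mul_cancel₀ _ hk0.ne', hrp]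
          ring
  have hB : ‖∑ j ∈ Finset.range k, q j * (1 / (s - 1) ^ (k - 1 - j + 1))‖ ≤
      (∑ j ∈ Finset.range k, ‖q j‖ * (2 ^ (k - 1 - j) * 3)) * (1 + |t|) ^ (η - 1) := by
    rw [Finset.sum_mul]
    refine norm_sum_le_of_le _ fun j _ => ?_
    rw [norm_mul, norm_div, norm_one, norm_pow, mul_assoc, mul_assoc]
    gcongr
    calc 1 / ‖s - 1‖ ^ (k - 1 - j + 1) = (1 / ‖s - 1‖) ^ (k - 1 - j) * (1 / ‖s - 1‖) := by
          rw [← pow_succ, div_pow, one_pow]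
      _ ≤ 2 ^ (k - 1 - j) * (3 / (1 + |t|)) := by gcongr
      _ ≤ 2 ^ (k - 1 - j) * (3 * (1 + |t|) ^ (η - 1)) := by
          gcongr
          rw [hrp, ← mul_div_assoc]
          gcongr
          linarith
  rw [hR, add_mul]
  exact (norm_sub_le _ _).trans (add_le_add hA hB)

/-- Interpolates between the linear bound for small `δ|s|` and the trivial bound for large `δ|s|`.
-/
theorem norm_cexp_sub_one_le {δ : ℝ} (hδ0 : 0 < δ) (hδ : δ ≤ 1) {s : ℂ} (hs : s.re = 1 / 2)
    {a : ℝ} (ha0 : 0 ≤ a) (ha : a ≤ 1) : ‖cexp (δ * s) - 1‖ ≤ 3 * (δ * ‖s‖) ^ a := by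
  have hn : ‖(δ : ℂ) * s‖ = δ * ‖s‖ := by rw [norm_mul, norm_real, Real.norm_of_nonneg hδ0.le]
  have hx : 0 ≤ δ * ‖s‖ := by positivity
  rcases le_or_gt (δ * ‖s‖) 1 with h | h
  · have h1 := Complex.norm_exp_sub_one_le (x := δ * s) (by rwa [hn])
    rw [hn] at h1
    have h2 : δ * ‖s‖ ≤ (δ * ‖s‖) ^ a := by
      rcases hx.eq_or_lt with h0 | h0
      · rw [← h0]; positivity
      · simpa using Real.rpow_le_rpow_of_exponent_ge h0 h ha
    linarith
  · have h1 : ‖cexp (δ * s) - 1‖ ≤ 3 := by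
      refine (norm_sub_le _ _).trans ?_
      rw [norm_exp, norm_one, re_ofReal_mul, hs]
      have h2 := Real.abs_exp_sub_one_le (x := δ * (1 / 2)) (by rw [abs_le]; constructor <;> linarith)
      rw [abs_le] at h2
      have h3 : |δ * (1 / 2)| ≤ 1 / 2 := by rw [abs_le]; constructor <;> linarith
      linarith [h2.2]
    have h2 := Real.one_le_rpow h.le ha0
    linarith

theorem exists_lintegral_logError_sub_le (hLH : LindelofHypothesis) {k : ℕ} (hk : 1 ≤ k)
    {q : ℕ → ℂ} {R : ℂ → ℂ} (h : IsPolarDecomposition k q R) {ε : ℝ} (hε : 0 < ε) (hε1 : ε ≤ 1) :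
    ∃ C : ℝ, 0 ≤ C ∧ ∀ δ : ℝ, 0 < δ → δ ≤ 1 →
      ∫⁻ u : ℝ, ‖(logError k q (u + δ) - logError k q u) * cexp (-(1 / 2) * u)‖ₑ ^ 2 ≤
        ENNReal.ofReal (C * δ ^ (1 - ε)) := by
  obtain ⟨B, hB0, hB⟩ := h.exists_norm_le
  obtain ⟨c, hc0, hc⟩ := h.exists_norm_le_half hLH hk (η := ε / 4) (by linarith)
  have hint : Integrable fun w : ℝ => (1 + ‖w‖) ^ (-(1 + ε / 2)) :=
    integrable_one_add_norm (by simp; linarith)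
  refine ⟨9 * c ^ 2 * ∫ w : ℝ, (1 + ‖w‖) ^ (-(1 + ε / 2)), by positivity, fun δ hδ0 hδ => ?_⟩
  set H : ℂ → ℂ := fun s => R s * (cexp (δ * s) - 1) with hH
  have hsplit : ∀ (s : ℂ) (v : ℝ), (logError k q (v + δ) - logError k q v) * cexp (-s * v) =
      cexp (δ * s) * (logError k q (v + δ) * cexp (-s * (v + δ : ℝ))) -
        logError k q v * cexp (-s * v) := by
    intro s v
    -- Translation by `δ` multiplies the transform by `e^{δs}`.
    have : cexp (-s * v) = cexp (δ * s) * cexp (-s * (v + δ : ℝ)) := by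
      rw [← Complex.exp_add]; push_cast; congr 1; ring
    rw [sub_mul]
    congr 1
    rw [this]
    ring
  have hshift : ∀ s : ℂ, 3 / 2 < s.re → Integrable fun v : ℝ =>
      cexp (δ * s) * (logError k q (v + δ) * cexp (-s * (v + δ : ℝ))) := fun s hs =>
    ((integrable_logError hk q hs).comp_add_right δ).const_mul _
  have hHd : DifferentiableOn ℂ H {s | 0 < s.re} := h.differentiableOn.mul (by fun_prop)
  have key := lintegral_sq_le_of_laplace (f := fun u => logError k q (u + δ) - logError k q u)
    (H := H) (C := B * (Real.exp 2 + 1)) (k := 2 * k) (by positivity) ?_ ?_ hHd ?_ ?_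
  · refine key.trans ?_
    rw [mul_right_comm, ← integral_const_mul, ofReal_integral_eq_lintegral_ofReal
      (hint.const_mul _) (.of_forall fun w => by positivity)]
    refine lintegral_mono fun w => ?_
    set t : ℝ := 2 * Real.pi * w with ht
    set s : ℂ := 1 / 2 + t * I with hs
    have hs2 : s.re = 1 / 2 := by simp [hs]
    have hpos : 0 < 1 + |t| := by positivity
    have hsn : ‖s‖ ≤ 1 + |t| := by
      refine (norm_add_le _ _).trans ?_
      rw [norm_mul, norm_I, norm_real, Real.norm_eq_abs]
      norm_num
    have hw : 1 + ‖w‖ ≤ 1 + |t| := by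
      rw [ht, abs_mul, abs_of_pos Real.two_pi_pos, Real.norm_eq_abs]
      have : 1 ≤ 2 * Real.pi := by linarith [Real.pi_gt_three]
      have := le_mul_of_one_le_left (abs_nonneg w) this
      linarith
    have h1 : ‖H s‖ ≤ c * (1 + |t|) ^ (ε / 4 - 1) * (3 * (δ * (1 + |t|)) ^ ((1 - ε) / 2)) := by
      simp only [hH, norm_mul]
      have h2 := norm_cexp_sub_one_le hδ0 hδ hs2 (a := (1 - ε) / 2) (by linarith) (by linarith)
      have h3 : (δ * ‖s‖) ^ ((1 - ε) / 2) ≤ (δ * (1 + |t|)) ^ ((1 - ε) / 2) := by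
        gcongr
      gcongr
      · exact hc t
      · linarith
    rw [← ofReal_norm, ← ENNReal.ofReal_pow (norm_nonneg _)]
    refine ENNReal.ofReal_le_ofReal ?_
    have hsq : ∀ (x : ℝ) (a : ℝ), 0 ≤ x → (x ^ a) ^ 2 = x ^ (2 * a) := fun x a hx => by
      rw [← Real.rpow_natCast, ← Real.rpow_mul hx, mul_comm]
      norm_num
    calc ‖H s‖ ^ 2 ≤ (c * (1 + |t|) ^ (ε / 4 - 1) * (3 * (δ * (1 + |t|)) ^ ((1 - ε) / 2))) ^ 2 := by
          gcongr
      -- The exponents `2(ε/4 - 1)` and `1 - ε` add up to `-(1 + ε/2)`, just enough for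
      -- integrability in `w`.
      _ = 9 * c ^ 2 * δ ^ (1 - ε) * (1 + |t|) ^ (-(1 + ε / 2)) := by
          rw [mul_pow, mul_pow, mul_pow, hsq _ _ hpos.le, hsq _ _ (by positivity),
            Real.mul_rpow hδ0.le (by positivity),
            show -(1 + ε / 2) = 2 * (ε / 4 - 1) + 2 * ((1 - ε) / 2) by ring, Real.rpow_add hpos,
            show 2 * ((1 - ε) / 2) = 1 - ε by ring]
          ring
      _ ≤ _ := by
          refine mul_le_mul_of_nonneg_left ?_ (by positivity)
          exact Real.rpow_le_rpow_of_nonpos (by positivity) hw (by linarith)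
  · simp_rw [hsplit]
    exact (hshift 2 (by norm_num)).sub (integrable_logError hk q (by norm_num))
  · have h1 := countable_not_continuousAt_logError k q
    have h2 : ((fun u : ℝ => u + δ) ⁻¹' {v | ¬ ContinuousAt (logError k q) v}).Countable :=
      h1.preimage (add_left_injective δ)
    filter_upwards [h1.ae_notMem volume, h2.ae_notMem volume] with u hu1 hu2
    simp only [mem_ofPred_eq, not_not, mem_preimage] at hu1 hu2
    exact (ContinuousAt.comp (f := fun u : ℝ => u + δ) hu2 (by fun_prop)).sub hu1
  · intro σ hσ t
    simp only [hH, norm_mul]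
    have h1 : ‖cexp (δ * (σ + t * I)) - 1‖ ≤ Real.exp 2 + 1 := by
      refine (norm_sub_le _ _).trans ?_
      rw [norm_exp, norm_one, re_ofReal_mul]
      gcongr
      simp
      nlinarith [hσ.1, hσ.2]
    calc _ ≤ B * (1 + |t|) ^ (2 * k) * (Real.exp 2 + 1) := by gcongr; exact hB σ hσ t
      _ = _ := by ring
  · intro t
    have hs : 3 / 2 < (2 + t * I : ℂ).re := by norm_num
    simp_rw [hsplit]
    rw [integral_sub (hshift _ hs) (integrable_logError hk q hs), integral_const_mul,
      integral_add_right_eq_self (fun v : ℝ => logError k q v * cexp (-(2 + t * I) * v)) δ,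
      integral_logError hk h hs]
    simp only [hH]
    ring

end PiltzDivisor

end

/-! ### From proportional differences to differences of fixed length. -/

noncomputable section

namespace PiltzDivisor

open Filter Topology MeasureTheory Set

/-- A measurable function on the line agreeing with `Δ_k` on `(1, ∞)`. -/
def truncDelta (k : ℕ) (q : ℕ → ℂ) (x : ℝ) : ℝ := (logError k q (Real.log x)).re

theorem measurable_truncDelta (k : ℕ) (q : ℕ → ℂ) : Measurable (truncDelta k q) := by
  have h1 : Measurable (logError k q) := by
    refine Measurable.indicator ?_ measurableSet_Ioi
    exact (Complex.measurable_ofReal.comp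
      ((monotone_divisorSum k).comp Real.exp_monotone).measurable).sub
      (continuous_mainTerm_exp k q).measurable
  exact Complex.measurable_re.comp (h1.comp Real.measurable_log)

theorem IsPolarDecomposition.truncDelta_eq {k : ℕ} {q : ℕ → ℂ} {R : ℂ → ℂ}
    (h : IsPolarDecomposition k q R) {x : ℝ} (hx : 1 < x) : truncDelta k q x = Delta k x := by
  have hx0 : 0 < x := by linarith
  rw [truncDelta, Delta, residue_eq_mainTerm h hx0, logError,
    indicator_of_mem (show Real.log x ∈ Ioi (0 : ℝ) from Real.log_pos hx), Real.exp_log hx0,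
    Complex.sub_re, Complex.ofReal_re, divisorSum]

/-- With `x = e^v`, multiplication by `1 + θ` is translation by `δ = log (1 + θ) ≤ θ`, and `e^{-v}
dv = x^{-2} dx`. -/
theorem exists_lintegral_truncDelta_le (hLH : LindelofHypothesis) {k : ℕ} (hk : 1 ≤ k)
    {q : ℕ → ℂ} {R : ℂ → ℂ} (h : IsPolarDecomposition k q R) {ε : ℝ} (hε : 0 < ε) (hε1 : ε ≤ 1) :
    ∃ C : ℝ, 0 ≤ C ∧ ∀ θ : ℝ, 0 < θ → θ ≤ 1 →
      ∫⁻ x in Ioi (1 : ℝ),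
        ENNReal.ofReal ((truncDelta k q (x + θ * x) - truncDelta k q x) ^ 2 / x ^ 2) ≤
          ENNReal.ofReal (C * θ ^ (1 - ε)) := by
  obtain ⟨C, hC0, hC⟩ := exists_lintegral_logError_sub_le hLH hk h hε hε1
  refine ⟨C, hC0, fun θ hθ0 hθ => ?_⟩
  have hδ0 : 0 < Real.log (1 + θ) := Real.log_pos (by linarith)
  have hδ : Real.log (1 + θ) ≤ θ := by
    have := Real.log_le_sub_one_of_pos (x := 1 + θ) (by linarith)
    linarith
  have h1 : ENNReal.ofReal (C * Real.log (1 + θ) ^ (1 - ε)) ≤ ENNReal.ofReal (C * θ ^ (1 - ε)) := by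
    apply ENNReal.ofReal_le_ofReal
    gcongr
  refine le_trans ?_ ((hC _ hδ0 (by linarith)).trans h1)
  have h2 := lintegral_image_eq_lintegral_abs_deriv_mul (s := Ioi (0 : ℝ)) measurableSet_Ioi
    (fun v _ => (Real.hasDerivAt_exp v).hasDerivWithinAt) Real.exp_injective.injOn
    fun x => ENNReal.ofReal ((truncDelta k q (x + θ * x) - truncDelta k q x) ^ 2 / x ^ 2)
  rw [Real.image_exp_Ioi, Real.exp_zero] at h2
  rw [h2]
  refine (lintegral_mono fun v => ?_).trans (setLIntegral_le_lintegral (Ioi (0 : ℝ)) _)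
  have h3 : Real.exp v + θ * Real.exp v = Real.exp v * (1 + θ) := by ring
  have h4 : Real.log (Real.exp v * (1 + θ)) = v + Real.log (1 + θ) := by
    rw [Real.log_mul (Real.exp_pos v).ne' (by linarith), Real.log_exp]
  simp only [truncDelta]
  rw [h3, h4, Real.log_exp, ← Complex.sub_re, ← ofReal_norm, ← ENNReal.ofReal_pow (norm_nonneg _),
    abs_of_pos (Real.exp_pos v), ← ENNReal.ofReal_mul (Real.exp_pos v).le]
  refine ENNReal.ofReal_le_ofReal ?_
  rw [norm_mul, mul_pow, Complex.norm_exp, ← Real.exp_nat_mul (-(1 / 2) * (v : ℂ)).re]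
  have h5 : Real.exp (((2 : ℕ) : ℝ) * (-(1 / 2) * (v : ℂ)).re) = Real.exp v / Real.exp v ^ 2 := by
    have : ((2 : ℕ) : ℝ) * (-(1 / 2) * (v : ℂ)).re = -v := by
      rw [show (-(1 / 2) * (v : ℂ)) = ((-(1 / 2) * v : ℝ) : ℂ) by push_cast; ring,
        Complex.ofReal_re]
      push_cast
      ring
    rw [this, Real.exp_neg]
    field_simp
  rw [h5]
  have h6 := Complex.abs_re_le_norm (logError k q (v + Real.log (1 + θ)) - logError k q v)
  have h7 : (logError k q (v + Real.log (1 + θ)) - logError k q v).re ^ 2 ≤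
      ‖logError k q (v + Real.log (1 + θ)) - logError k q v‖ ^ 2 := by
    rw [← sq_abs]; gcongr
  rw [mul_div_assoc', mul_div_assoc', mul_comm (Real.exp v)]
  gcongr

section ShortIntervals

variable {D : ℝ → ℝ}

theorem measurable_sq_sub (hD : Measurable D) {α : Type*} [MeasurableSpace α] {f g : α → ℝ}
    (hf : Measurable f) (hg : Measurable g) :
    Measurable fun a => ENNReal.ofReal ((D (f a) - D (g a)) ^ 2) :=
  (((hD.comp hf).sub (hD.comp hg)).pow_const 2).ennreal_ofReal

theorem ofReal_sq_sub_le (a b c : ℝ) : ENNReal.ofReal ((a - c) ^ 2) ≤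
    2 * ENNReal.ofReal ((b - c) ^ 2) + 2 * ENNReal.ofReal ((b - a) ^ 2) := by
  rw [← ENNReal.ofReal_ofNat 2, ← ENNReal.ofReal_mul (by norm_num),
    ← ENNReal.ofReal_mul (by norm_num), ← ENNReal.ofReal_add (by positivity) (by positivity)]
  refine ENNReal.ofReal_le_ofReal ?_
  nlinarith [sq_nonneg (a + c - 2 * b)]

theorem setLIntegral_comp_add_le {J : ℝ → ENNReal} {s t : Set ℝ} (hs : MeasurableSet s)
    (ht : MeasurableSet t) (h : ℝ) (hst : ∀ x ∈ s, x + h ∈ t) :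
    ∫⁻ x in s, J (x + h) ≤ ∫⁻ x in t, J x := by
  rw [← lintegral_indicator hs, ← lintegral_indicator ht,
    ← lintegral_add_right_eq_self (t.indicator J) h]
  refine lintegral_mono fun x => ?_
  by_cases hx : x ∈ s
  · rw [indicator_of_mem hx, indicator_of_mem (hst x hx)]
  · rw [indicator_of_notMem hx]; exact bot_le

/-- A fixed short difference is dominated by an average over the length of the difference. -/
theorem ofReal_mul_lintegral_sq_sub_le (hD : Measurable D) {X h : ℝ} (hh : 0 < h) (hX : h ≤ X) :
    ENNReal.ofReal h * ∫⁻ x in Ioc X (2 * X), ENNReal.ofReal ((D (x + h) - D x) ^ 2) ≤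
      4 * ∫⁻ x in Ioc X (3 * X), ∫⁻ v in Icc h (3 * h),
        ENNReal.ofReal ((D (x + v) - D x) ^ 2) := by
  set J : ℝ → ENNReal := fun x => ∫⁻ v in Icc h (3 * h), ENNReal.ofReal ((D (x + v) - D x) ^ 2)
    with hJ
  have hJm : Measurable J := by
    have hm : Measurable fun p : ℝ × ℝ => ENNReal.ofReal ((D (p.1 + p.2) - D p.1) ^ 2) :=
      measurable_sq_sub hD (by fun_prop) (by fun_prop)
    exact hm.lintegral_prod_right'
  have hpt : ∀ x, ENNReal.ofReal h * ENNReal.ofReal ((D (x + h) - D x) ^ 2) ≤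
      2 * J x + 2 * J (x + h) := by
    intro x
    have hvol : volume (Icc (2 * h) (3 * h)) = ENNReal.ofReal h := by
      rw [Real.volume_Icc]; congr 1; ring
    have hm1 : Measurable fun v => ENNReal.ofReal ((D (x + v) - D x) ^ 2) :=
      measurable_sq_sub hD (by fun_prop) (by fun_prop)
    calc ENNReal.ofReal h * ENNReal.ofReal ((D (x + h) - D x) ^ 2)
        = ∫⁻ v in Icc (2 * h) (3 * h), ENNReal.ofReal ((D (x + h) - D x) ^ 2) := by
          rw [setLIntegral_const, hvol, mul_comm]
      -- Both increments end at `x + v`: one starts at `x` with length `v`, the other at `x + h`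
      -- with length `v - h`. Both lengths lie in `[h, 3h]`.
      _ ≤ ∫⁻ v in Icc (2 * h) (3 * h), (2 * ENNReal.ofReal ((D (x + v) - D x) ^ 2) +
            2 * ENNReal.ofReal ((D (x + h + (v + -h)) - D (x + h)) ^ 2)) := by
          refine lintegral_mono fun v => ?_
          have : x + h + (v + -h) = x + v := by ring
          simp only [this]
          exact ofReal_sq_sub_le _ _ _
      _ = 2 * (∫⁻ v in Icc (2 * h) (3 * h), ENNReal.ofReal ((D (x + v) - D x) ^ 2)) +
            2 * ∫⁻ v in Icc (2 * h) (3 * h),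
              ENNReal.ofReal ((D (x + h + (v + -h)) - D (x + h)) ^ 2) := by
          rw [lintegral_add_left (hm1.const_mul _), lintegral_const_mul _ hm1,
            lintegral_const_mul' _ _ (by norm_num)]
      _ ≤ _ := by
          gcongr
          · exact lintegral_mono_set (Icc_subset_Icc_left (by linarith))
          · refine setLIntegral_comp_add_le
              (J := fun v => ENNReal.ofReal ((D (x + h + v) - D (x + h)) ^ 2))
              measurableSet_Icc measurableSet_Icc (-h) fun v hv => ?_
            constructor <;> linarith [hv.1, hv.2]
  calc ENNReal.ofReal h * ∫⁻ x in Ioc X (2 * X), ENNReal.ofReal ((D (x + h) - D x) ^ 2)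
      = ∫⁻ x in Ioc X (2 * X), ENNReal.ofReal h * ENNReal.ofReal ((D (x + h) - D x) ^ 2) :=
        (lintegral_const_mul' _ _ ENNReal.ofReal_ne_top).symm
    _ ≤ ∫⁻ x in Ioc X (2 * X), (2 * J x + 2 * J (x + h)) := lintegral_mono hpt
    _ = 2 * (∫⁻ x in Ioc X (2 * X), J x) + 2 * ∫⁻ x in Ioc X (2 * X), J (x + h) := by
        rw [lintegral_add_left (hJm.const_mul _), lintegral_const_mul _ hJm,
          lintegral_const_mul' _ _ (by norm_num)]
    _ ≤ 2 * (∫⁻ x in Ioc X (3 * X), J x) + 2 * ∫⁻ x in Ioc X (3 * X), J x := by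
        refine add_le_add (mul_le_mul_right ?_ 2) (mul_le_mul_right ?_ 2)
        · exact lintegral_mono_set (Ioc_subset_Ioc_right (by linarith))
        · refine setLIntegral_comp_add_le measurableSet_Ioc measurableSet_Ioc h fun x hx => ?_
          constructor <;> linarith [hx.1, hx.2]
    _ = _ := by rw [← add_mul]; norm_num

theorem lintegral_eq_ofReal_mul_lintegral_comp_mul {g : ℝ → ENNReal} (hg : Measurable g) {x : ℝ}
    (hx : 0 < x) : ∫⁻ v, g v = ENNReal.ofReal x * ∫⁻ θ, g (x * θ) := by
  conv_lhs => rw [← Real.smul_map_volume_mul_left hx.ne']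
  rw [lintegral_smul_measure, lintegral_map hg (by fun_prop), abs_of_pos hx, smul_eq_mul]

/-- Saffari–Vaughan: mean squares of differences of proportional length control mean squares of
differences of fixed length. -/
theorem lintegral_lintegral_sq_sub_le (hD : Measurable D) {C ε : ℝ} (hC : 0 ≤ C) (hε1 : ε ≤ 1)
    (hDθ : ∀ θ : ℝ, 0 < θ → θ ≤ 1 → ∫⁻ x in Ioi (1 : ℝ),
      ENNReal.ofReal ((D (x + θ * x) - D x) ^ 2 / x ^ 2) ≤ ENNReal.ofReal (C * θ ^ (1 - ε)))
    {X h : ℝ} (hh : 0 < h) (hX1 : 1 ≤ X) (hX : 3 * h ≤ X) :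
    ∫⁻ x in Ioc X (3 * X), ∫⁻ v in Icc h (3 * h), ENNReal.ofReal ((D (x + v) - D x) ^ 2) ≤
      ENNReal.ofReal (27 * C * X ^ 3 * (3 * h / X) ^ (2 - ε)) := by
  have hX0 : 0 < X := by linarith
  -- Contains every `θ = v/x` with `h ≤ v ≤ 3h` and `X < x ≤ 3X`; the assumption `3h ≤ X` keeps `θ ≤
  -- 1`.
  set Θ : Set ℝ := Icc (h / (3 * X)) (3 * h / X) with hΘ
  have hinner : ∀ x ∈ Ioc X (3 * X), ∫⁻ v in Icc h (3 * h), ENNReal.ofReal ((D (x + v) - D x) ^ 2) ≤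
      ENNReal.ofReal (3 * X) * ∫⁻ θ in Θ, ENNReal.ofReal ((D (x + θ * x) - D x) ^ 2) := by
    intro x hx
    have hx0 : 0 < x := hX0.trans hx.1
    have hm : Measurable fun v => ENNReal.ofReal ((D (x + v) - D x) ^ 2) :=
      measurable_sq_sub hD (by fun_prop) (by fun_prop)
    rw [← lintegral_indicator measurableSet_Icc, ← lintegral_indicator measurableSet_Icc,
      lintegral_eq_ofReal_mul_lintegral_comp_mul (hm.indicator measurableSet_Icc) hx0]
    gcongr with θ
    · exact hx.2
    · by_cases hθ : x * θ ∈ Icc h (3 * h)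
      · have hθ' : θ ∈ Θ := by
          have hθ0 : 0 < θ := pos_of_mul_pos_right (hh.trans_le hθ.1) hx0.le
          constructor
          · rw [div_le_iff₀ (by positivity)]
            nlinarith [hθ.1, hx.2]
          · rw [le_div_iff₀ hX0]
            nlinarith [hθ.2, hx.1]
        rw [indicator_of_mem hθ, indicator_of_mem hθ', mul_comm θ]
      · rw [indicator_of_notMem hθ]; exact bot_le
  have hm2 : Measurable fun p : ℝ × ℝ => ENNReal.ofReal ((D (p.1 + p.2 * p.1) - D p.1) ^ 2) :=
    measurable_sq_sub hD (by fun_prop) (by fun_prop)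
  have houter : ∀ θ ∈ Θ, ∫⁻ x in Ioc X (3 * X), ENNReal.ofReal ((D (x + θ * x) - D x) ^ 2) ≤
      ENNReal.ofReal (9 * X ^ 2 * (C * (3 * h / X) ^ (1 - ε))) := by
    intro θ hθ
    have hθ0 : 0 < θ := lt_of_lt_of_le (by positivity) hθ.1
    have hθ1 : θ ≤ 1 := hθ.2.trans ((div_le_one hX0).2 hX)
    calc ∫⁻ x in Ioc X (3 * X), ENNReal.ofReal ((D (x + θ * x) - D x) ^ 2)
        ≤ ∫⁻ x in Ioc X (3 * X), ENNReal.ofReal (9 * X ^ 2) *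
            ENNReal.ofReal ((D (x + θ * x) - D x) ^ 2 / x ^ 2) := by
          refine setLIntegral_mono' measurableSet_Ioc fun x hx => ?_
          have hx0 : 0 < x := hX0.trans hx.1
          rw [← ENNReal.ofReal_mul (by positivity)]
          refine ENNReal.ofReal_le_ofReal ?_
          rw [← mul_div_assoc, le_div_iff₀ (by positivity), mul_comm]
          gcongr
          nlinarith [hx.2]
      _ = ENNReal.ofReal (9 * X ^ 2) *
            ∫⁻ x in Ioc X (3 * X), ENNReal.ofReal ((D (x + θ * x) - D x) ^ 2 / x ^ 2) :=
          lintegral_const_mul' _ _ ENNReal.ofReal_ne_top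
      _ ≤ ENNReal.ofReal (9 * X ^ 2) * ENNReal.ofReal (C * θ ^ (1 - ε)) := by
          gcongr
          refine le_trans (lintegral_mono_set fun x hx => ?_) (hDθ θ hθ0 hθ1)
          exact lt_of_le_of_lt hX1 hx.1
      _ ≤ _ := by
          rw [← ENNReal.ofReal_mul (by positivity)]
          refine ENNReal.ofReal_le_ofReal ?_
          gcongr
          exact hθ.2
  calc ∫⁻ x in Ioc X (3 * X), ∫⁻ v in Icc h (3 * h), ENNReal.ofReal ((D (x + v) - D x) ^ 2)
      ≤ ∫⁻ x in Ioc X (3 * X), ENNReal.ofReal (3 * X) *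
          ∫⁻ θ in Θ, ENNReal.ofReal ((D (x + θ * x) - D x) ^ 2) :=
        setLIntegral_mono' measurableSet_Ioc hinner
    _ = ENNReal.ofReal (3 * X) * ∫⁻ θ in Θ, ∫⁻ x in Ioc X (3 * X),
          ENNReal.ofReal ((D (x + θ * x) - D x) ^ 2) := by
        rw [lintegral_const_mul' _ _ ENNReal.ofReal_ne_top, lintegral_lintegral_swap hm2.aemeasurable]
    _ ≤ ENNReal.ofReal (3 * X) * ∫⁻ _ in Θ,
          ENNReal.ofReal (9 * X ^ 2 * (C * (3 * h / X) ^ (1 - ε))) := by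
        gcongr 1
        exact setLIntegral_mono' measurableSet_Icc houter
    _ ≤ ENNReal.ofReal (3 * X) * (ENNReal.ofReal (9 * X ^ 2 * (C * (3 * h / X) ^ (1 - ε))) *
          ENNReal.ofReal (3 * h / X)) := by
        rw [setLIntegral_const, hΘ, Real.volume_Icc]
        gcongr
        have : 0 ≤ h / (3 * X) := by positivity
        linarith
    _ = _ := by
        rw [← ENNReal.ofReal_mul (by positivity), ← ENNReal.ofReal_mul (by positivity)]
        congr 1
        rw [show 2 - ε = (1 - ε) + 1 by ring, Real.rpow_add (by positivity), Real.rpow_one]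
        ring

end ShortIntervals

theorem exists_lintegral_truncDelta_sub_le (hLH : LindelofHypothesis) {k : ℕ} (hk : 1 ≤ k)
    {q : ℕ → ℂ} {R : ℂ → ℂ} (hR : IsPolarDecomposition k q R) {ε : ℝ} (hε : 0 < ε) (hε1 : ε ≤ 1) :
    ∃ C : ℝ, 0 < C ∧ ∀ X h : ℝ, 1 ≤ h → h ≤ X / 8 →
      ∫⁻ x in Ioc X (2 * X), ENNReal.ofReal ((truncDelta k q (x + h) - truncDelta k q x) ^ 2) ≤
        ENNReal.ofReal (C * h * X ^ ε * X) := by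
  obtain ⟨C, hC0, hC⟩ := exists_lintegral_truncDelta_le hLH hk hR hε hε1
  -- `972 = 4 · 27 · 9`, from the averaging step, the Saffari–Vaughan bound and `(3h)²`; the `+ 1`
  -- makes the constant positive.
  refine ⟨972 * C + 1, by positivity, fun X h hh hX => ?_⟩
  have hh0 : 0 < h := by linarith
  have hX0 : 0 < X := by linarith
  have h1 := (ofReal_mul_lintegral_sq_sub_le (measurable_truncDelta k q) hh0
    (by linarith : h ≤ X)).trans (mul_le_mul_right (lintegral_lintegral_sq_sub_le
      (measurable_truncDelta k q) hC0 hε1 hC hh0 (by linarith) (by linarith)) 4)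
  have h2 : 4 * ENNReal.ofReal (27 * C * X ^ 3 * (3 * h / X) ^ (2 - ε)) ≤
      ENNReal.ofReal h * ENNReal.ofReal ((972 * C + 1) * h * X ^ ε * X) := by
    rw [← ENNReal.ofReal_ofNat 4, ← ENNReal.ofReal_mul (by norm_num), ← ENNReal.ofReal_mul hh0.le]
    refine ENNReal.ofReal_le_ofReal ?_
    have h3 : (3 * h / X) ^ (2 - ε) ≤ 9 * h ^ 2 / X ^ 2 * X ^ ε := by
      rw [Real.rpow_sub (by positivity), div_eq_mul_inv _ ((3 * h / X) ^ ε),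
        ← Real.inv_rpow (by positivity), inv_div]
      have h4 : (3 * h / X) ^ (2 : ℝ) = 9 * h ^ 2 / X ^ 2 := by
        rw [Real.rpow_two]; ring
      rw [h4]
      gcongr
      exact div_le_self hX0.le (by linarith)
    calc 4 * (27 * C * X ^ 3 * (3 * h / X) ^ (2 - ε))
        ≤ 4 * (27 * C * X ^ 3 * (9 * h ^ 2 / X ^ 2 * X ^ ε)) := by gcongr
      _ = h * ((972 * C) * h * X ^ ε * X) := by field_simp; ring
      _ ≤ _ := by gcongr; linarith
  -- The factor `h` introduced by averaging over `v` is cancelled.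
  refine (ENNReal.mul_le_mul_iff_right ?_ ENNReal.ofReal_ne_top).1 (h1.trans h2)
  simpa using hh0

end PiltzDivisor

end

/-! ### The mean square in short intervals. -/

theorem corollary2 (hLH : PiltzDivisor.LindelofHypothesis) (k : ℕ) (hk : 3 ≤ k)
    (ε : ℝ) (hε : 0 < ε) :
    ∃ C : ℝ, 0 < C ∧ ∀ X h : ℝ, 1 ≤ h → h ≤ X / 8 →
      IntervalIntegrable
        (fun x : ℝ => (PiltzDivisor.Delta k (x + h) - PiltzDivisor.Delta k x) ^ 2)
        MeasureTheory.volume X (2 * X) ∧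
      1 / X * ∫ x in X..(2 * X), (PiltzDivisor.Delta k (x + h) - PiltzDivisor.Delta k x) ^ 2
        ≤ C * h * X ^ ε := by
  obtain ⟨q, R, hR⟩ := PiltzDivisor.exists_isPolarDecomposition k
  -- The exponent `(1 - ε)/2` must be nonnegative, so `ε` is capped at `1`; since `X ≥ 1` this only
  -- strengthens the bound.
  obtain ⟨C, hC0, hC⟩ := PiltzDivisor.exists_lintegral_truncDelta_sub_le hLH (by omega : 1 ≤ k) hR
    (ε := min ε 1) (lt_min hε one_pos) (min_le_right _ _)
  refine ⟨C, hC0, fun X h hh hX => ?_⟩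
  have hX0 : 0 < X := by linarith
  have hle : X ≤ 2 * X := by linarith
  have hbound := hC X h hh hX
  set g : ℝ → ℝ := fun x =>
    (PiltzDivisor.truncDelta k q (x + h) - PiltzDivisor.truncDelta k q x) ^ 2 with hg
  have hcongr : Set.EqOn g
      (fun x => (PiltzDivisor.Delta k (x + h) - PiltzDivisor.Delta k x) ^ 2)
      (Set.Ioc X (2 * X)) := by
    intro x hx
    simp only [hg]
    -- Here `x > X ≥ 8h ≥ 8`, so both arguments exceed `1`, where the truncation has no effect.
    rw [hR.truncDelta_eq (by linarith [hx.1]), hR.truncDelta_eq (by linarith [hx.1])]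
  have hgm : Measurable g :=
    (((PiltzDivisor.measurable_truncDelta k q).comp (measurable_id.add_const h)).sub
      (PiltzDivisor.measurable_truncDelta k q)).pow_const 2
  have hg0 : ∀ x, 0 ≤ g x := fun x => sq_nonneg _
  have hgi : MeasureTheory.IntegrableOn g (Set.Ioc X (2 * X)) := by
    refine ⟨hgm.aestronglyMeasurable, ?_⟩
    rw [MeasureTheory.hasFiniteIntegral_iff_ofReal (.of_forall hg0)]
    exact hbound.trans_lt ENNReal.ofReal_lt_top
  refine ⟨?_, ?_⟩
  · rw [intervalIntegrable_iff_integrableOn_Ioc_of_le hle]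
    exact hgi.congr_fun hcongr measurableSet_Ioc
  · rw [intervalIntegral.integral_of_le hle,
      ← MeasureTheory.setIntegral_congr_fun measurableSet_Ioc hcongr,
      MeasureTheory.integral_eq_lintegral_of_nonneg_ae (.of_forall hg0)
        hgm.aestronglyMeasurable]
    have h1 := ENNReal.toReal_mono ENNReal.ofReal_ne_top hbound
    rw [ENNReal.toReal_ofReal (by positivity)] at h1
    have h2 : X ^ min ε 1 ≤ X ^ ε :=
      Real.rpow_le_rpow_of_exponent_le (by linarith) (min_le_left _ _)
    rw [one_div, inv_mul_le_iff₀ hX0]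
    calc _ ≤ C * h * X ^ min ε 1 * X := h1
      _ ≤ X * (C * h * X ^ ε) := by
        rw [mul_comm X]
        gcongr
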